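/- For $0<k<1$ let $K(k)=\int_0^{\pi/2}\frac{d\varphi}{\sqrt{1-k^2\sin^2\varphi}}$ be the complete elliptic integral of the first kind with modulus $k$, and let $k'=\sqrt{1-k^2}$. For every real $\alpha>0$ there is exactly one $k\in(0,1)$ with $K(k')/K(k)=\alpha$; with this $k$ and with $K=K(k)$ the following holds. (1) If $\alpha>\frac{\ln 2}{2\pi}$, then $$\int_0^{\pi/2}\ln\left(\cosh\frac{x}{\alpha}-\cos\frac{\ln(2\cos x)}{\alpha}\right)dx=-\frac{\pi^2\alpha}{12}-\frac{\pi}{6}\ln\frac{16\,k\,k'K^3\alpha^6}{\pi^3}.$$ (2) If $\alpha>\frac{\ln 2}{\pi}$, then $$\int_0^{\pi/2}\ln\left(\cosh\frac{x}{\alpha}+\cos\frac{\ln(2\cos x)}{\alpha}\right)dx=\frac{\pi^2\alpha}{24}+\frac{\pi}{6}\ln\frac{4\sqrt{k}}{k'}.$$ In both cases the integrand is integrable on $[0,\pi/2]$. -/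

import Mathlib

open Real

/-- The complete elliptic integral of the first kind with modulus `k`. -/
noncomputable def ellipticK (k : ℝ) : ℝ :=
  ∫ φ in (0 : ℝ)..(π / 2), 1 / √(1 - k ^ 2 * sin φ ^ 2)

/-- The complementary modulus of `k`. -/
noncomputable def complModulus (k : ℝ) : ℝ := √(1 - k ^ 2)

/-! Put `z = exp (2ix)`. Then `1 + z = 2 cos x · exp (ix)`, so `u = log (1 + z) / (2α)` has `2 Re u
= log (2 cos x) / α` and `2 Im u = x / α`, and the two integrands are `log (2 |sin u|²)` and `log (2
|cos u|²)`. By conjugation symmetry each integral is, up to constants, the mean of `log |sin u|` or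
`log |cos u|` over the unit circle.

Jensen's formula computes these means from the zeros in the disc, which lie where `log (1 + z)` is a
suitable real multiple of `πα`. The disc forces `log (1 + z) < log 2` at such points, so the lower
bounds on `α` exclude every positive multiple. With `q = exp (-πα)`, the remaining zeros produce `∏
(1 - q ^ (2n))` for `sin` and `∏ (1 - q ^ (2n - 1))` for `cos` (`circleAverage_log_norm_sin`,
`circleAverage_log_norm_cos`).

These products are then expressed through `k`, `k'` and `K`. Gauss's product for the triangular
theta series (`thetaTri_eq`) and lattice identities give Jacobi's relations. The squares of `thetaSq
q` and `thetaSq (-q)` follow the arithmetic-geometric mean as `q` becomes `q²`, whence `K = π/2 ·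
thetaSq q ^ 2` (`ellipticK_modulusOfNome`). Poisson summation gives `K(k') / K(k) = α`, and
monotonicity makes `k` unique. -/

open Filter Topology

/-! ### Theta series and their quadratic identities -/

/-- The theta series `∑ q ^ n²` over the integers. -/
noncomputable def thetaSq (q : ℝ) : ℝ := ∑' n : ℤ, q ^ (n ^ 2 : ℤ)

/-- The theta series `∑ q ^ (n (n + 1) / 2)` over the integers. -/
noncomputable def thetaTri (q : ℝ) : ℝ := ∑' n : ℤ, q ^ (n * (n + 1) / 2 : ℤ)

theorem abs_lt_one_sq {q : ℝ} (h : |q| < 1) : |q ^ 2| < 1 := by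
  rw [abs_pow]; exact pow_lt_one₀ (abs_nonneg _) h (by norm_num)

/-- Linear growth of the exponent allows comparison with a geometric series. The loss of 1
accommodates `n (n + 1) / 2`, which vanishes at `n = -1`. -/
theorem summable_norm_zpow {q : ℝ} (h0 : q ≠ 0) (h1 : |q| < 1) {e : ℤ → ℤ}
    (he : ∀ n, |n| - 1 ≤ e n) : Summable fun n : ℤ => ‖q ^ e n‖ := by
  have hs : Summable fun n : ℤ => |q| ^ n.natAbs := by
    rw [summable_int_iff_summable_nat_and_neg]
    have := summable_geometric_of_lt_one (abs_nonneg q) h1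
    constructor <;> simpa using this
  refine Summable.of_nonneg_of_le (fun _ => norm_nonneg _) (fun n => ?_) (hs.mul_right |q|⁻¹)
  have hq : 0 < |q| := abs_pos.2 h0
  rw [norm_zpow, norm_eq_abs, ← zpow_natCast, ← zpow_neg_one, ← zpow_add₀ hq.ne']
  apply zpow_le_zpow_right_of_le_one₀ hq h1.le
  have := he n
  simpa [sub_eq_add_neg] using this

theorem abs_sub_one_le_sq (n : ℤ) : |n| - 1 ≤ n ^ 2 := by
  rcases abs_cases n with ⟨h, _⟩ | ⟨h, _⟩ <;> rw [h] <;> nlinarith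

theorem abs_sub_one_le_tri (n : ℤ) : |n| - 1 ≤ n * (n + 1) / 2 := by
  rw [Int.le_ediv_iff_mul_le (by norm_num)]
  rcases abs_cases n with ⟨h, h'⟩ | ⟨h, h'⟩ <;> rw [h]
  · nlinarith [sq_nonneg (n - 1)]
  · have : 0 ≤ (n + 1) * (n + 2) := by
      rcases lt_or_ge (n + 1) 0 with h | h
      · nlinarith
      · nlinarith
    nlinarith

theorem two_dvd_tri (n : ℤ) : 2 ∣ n * (n + 1) := (Int.even_mul_succ_self n).two_dvd

/-- Points of `ℤ²` are split by the parity of their coordinate sum, each class being a rotated copy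
of `ℤ²`. Both quadratic theta identities below come from this splitting. -/
theorem tsum_prod_parity {F : ℤ × ℤ → ℝ} (hF : Summable F) :
    ∑' p, F p = ∑' p : ℤ × ℤ, F (p.1 + p.2, p.1 - p.2) +
      ∑' p : ℤ × ℤ, F (p.1 + p.2 + 1, p.1 - p.2) := by
  let f : ℤ × ℤ → ℤ × ℤ := fun p => (p.1 + p.2, p.1 - p.2)
  let g : ℤ × ℤ → ℤ × ℤ := fun p => (p.1 + p.2 + 1, p.1 - p.2)
  have hf : Function.Injective f := by
    rintro ⟨a, b⟩ ⟨c, d⟩ h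
    simp only [f, Prod.mk.injEq] at h ⊢
    omega
  have hg : Function.Injective g := by
    rintro ⟨a, b⟩ ⟨c, d⟩ h
    simp only [g, Prod.mk.injEq] at h ⊢
    omega
  have hc : (Set.range f)ᶜ = Set.range g := by
    ext ⟨a, b⟩
    simp only [Set.mem_compl_iff, Set.mem_range, Prod.exists, f, g, Prod.mk.injEq]
    constructor
    · intro h
      by_cases hab : (a + b) % 2 = 0
      · exact absurd ⟨(a + b) / 2, (a - b) / 2, by omega, by omega⟩ h
      · exact ⟨(a + b - 1) / 2, (a - b - 1) / 2, by omega, by omega⟩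
    · rintro ⟨c, d, h1, h2⟩ ⟨c', d', h3, h4⟩
      omega
  have h := Summable.tsum_add_tsum_compl (s := Set.range f) (hF.comp_injective
    Subtype.val_injective) (hF.comp_injective Subtype.val_injective)
  rw [hc, tsum_range F hf, tsum_range F hg] at h
  exact h.symm

theorem tsum_zpow_mul_tsum_zpow {q r : ℝ} {e e' : ℤ → ℤ} (he : Summable fun n : ℤ => ‖q ^ e n‖)
    (he' : Summable fun n : ℤ => ‖r ^ e' n‖) :
    (∑' n, q ^ e n) * ∑' n, r ^ e' n = ∑' p : ℤ × ℤ, q ^ e p.1 * r ^ e' p.2 :=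
  tsum_mul_tsum_of_summable_norm he he'

/-- On the even class `(a + b)² + (a - b)² = 2a² + 2b²`; on the odd class `(a + b + 1)² + (a - b)² =
1 + 2a(a + 1) + 2b(b + 1)`. -/
theorem thetaSq_sq {q : ℝ} (h0 : q ≠ 0) (h1 : |q| < 1) :
    thetaSq q ^ 2 = thetaSq (q ^ 2) ^ 2 + q * thetaTri (q ^ 4) ^ 2 := by
  have s := summable_norm_zpow h0 h1 abs_sub_one_le_sq
  have s2 := summable_norm_zpow (pow_ne_zero 2 h0) (abs_lt_one_sq h1) abs_sub_one_le_sq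
  have h4 : |q ^ 4| < 1 := by
    have := abs_lt_one_sq (abs_lt_one_sq h1)
    rwa [← pow_mul] at this
  have s4 := summable_norm_zpow (pow_ne_zero 4 h0) h4 abs_sub_one_le_tri
  simp only [thetaSq, thetaTri, sq (tsum _)]
  rw [tsum_zpow_mul_tsum_zpow s s, tsum_zpow_mul_tsum_zpow s2 s2, tsum_zpow_mul_tsum_zpow s4 s4,
    tsum_prod_parity (summable_mul_of_summable_norm s s), ← tsum_mul_left]
  congr 1
  · refine tsum_congr fun p => ?_
    rw [← zpow_add₀ h0, ← zpow_natCast q 2, ← zpow_mul, ← zpow_mul, ← zpow_add₀ h0]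
    congr 1; push_cast; ring
  · refine tsum_congr fun p => ?_
    rw [← zpow_add₀ h0, ← zpow_natCast q 4, ← zpow_mul, ← zpow_mul, ← zpow_add₀ h0,
      ← zpow_one_add₀ h0]
    obtain ⟨x, hx⟩ := two_dvd_tri p.1
    obtain ⟨y, hy⟩ := two_dvd_tri p.2
    rw [hx, hy]
    congr 1
    rw [Int.mul_ediv_cancel_left _ (by norm_num), Int.mul_ediv_cancel_left _ (by norm_num)]
    push_cast
    linear_combination 2 * hx + 2 * hy

/-- Both parity classes contribute the same product: the exponents become `a(a + 1) + b²` and `(a +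
1)² + b(b + 1)`. The second needs the square series shifted by one. -/
theorem thetaTri_sq {q : ℝ} (h0 : q ≠ 0) (h1 : |q| < 1) :
    thetaTri q ^ 2 = 2 * thetaTri (q ^ 2) * thetaSq q := by
  have s := summable_norm_zpow h0 h1 abs_sub_one_le_sq
  have st := summable_norm_zpow h0 h1 abs_sub_one_le_tri
  have s2 := summable_norm_zpow (pow_ne_zero 2 h0) (abs_lt_one_sq h1) abs_sub_one_le_tri
  have hsh := (Equiv.addRight (1 : ℤ)).tsum_eq fun n : ℤ => q ^ (n ^ 2 : ℤ)
  have ssh := s.comp_injective (Equiv.addRight (1 : ℤ)).injective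
  simp only [Equiv.coe_addRight] at hsh ssh
  have e1 : thetaTri (q ^ 2) * thetaSq q =
      ∑' p : ℤ × ℤ, q ^ ((p.1 + p.2) * (p.1 + p.2 + 1) / 2) *
        q ^ ((p.1 - p.2) * (p.1 - p.2 + 1) / 2) := by
    rw [thetaTri, thetaSq, tsum_zpow_mul_tsum_zpow s2 s]
    refine tsum_congr fun p => ?_
    rw [← zpow_add₀ h0, ← zpow_natCast q 2, ← zpow_mul, ← zpow_add₀ h0]
    obtain ⟨x, hx⟩ := two_dvd_tri p.1
    obtain ⟨y, hy⟩ := two_dvd_tri (p.1 + p.2)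
    obtain ⟨z, hz⟩ := two_dvd_tri (p.1 - p.2)
    rw [hx, hy, hz]
    congr 1
    simp only [Int.mul_ediv_cancel_left _ (two_ne_zero : (2 : ℤ) ≠ 0)]
    apply mul_left_cancel₀ (two_ne_zero : (2 : ℤ) ≠ 0)
    push_cast
    linear_combination -2 * hx + hy + hz
  have e2 : thetaTri (q ^ 2) * thetaSq q =
      ∑' p : ℤ × ℤ, q ^ ((p.1 + p.2 + 1) * (p.1 + p.2 + 1 + 1) / 2) *
        q ^ ((p.1 - p.2) * (p.1 - p.2 + 1) / 2) := by
    rw [mul_comm, thetaTri, thetaSq, ← hsh,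
      tsum_zpow_mul_tsum_zpow (e := fun n => (n + 1) ^ 2) ssh s2]
    refine tsum_congr fun p => ?_
    rw [← zpow_add₀ h0, ← zpow_natCast q 2, ← zpow_mul, ← zpow_add₀ h0]
    obtain ⟨x, hx⟩ := two_dvd_tri p.2
    obtain ⟨y, hy⟩ := two_dvd_tri (p.1 + p.2 + 1)
    obtain ⟨z, hz⟩ := two_dvd_tri (p.1 - p.2)
    rw [hx, hy, hz]
    congr 1
    simp only [Int.mul_ediv_cancel_left _ (two_ne_zero : (2 : ℤ) ≠ 0)]
    apply mul_left_cancel₀ (two_ne_zero : (2 : ℤ) ≠ 0)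
    push_cast
    linear_combination -2 * hx + hy + hz
  rw [mul_assoc, two_mul]
  nth_rewrite 1 [e1]
  rw [e2, sq, thetaTri, tsum_zpow_mul_tsum_zpow st st,
    tsum_prod_parity (summable_mul_of_summable_norm st st)]

/-! ### Gauss's product for the triangular series, by Shanks's finite identity -/

/-- The finite product `∏ (1 - q ^ (2 s)) / (1 - q ^ (2 s - 1))` over `1 ≤ s ≤ n`. -/
noncomputable def gaussProd (q : ℝ) (n : ℕ) : ℝ :=
  ∏ s ∈ Finset.range n, (1 - q ^ (2 * s + 2)) / (1 - q ^ (2 * s + 1))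

theorem one_sub_pow_pos {q : ℝ} (h1 : |q| < 1) {n : ℕ} (hn : n ≠ 0) : 0 < 1 - q ^ n := by
  have : |q ^ n| < 1 := by rw [abs_pow]; exact pow_lt_one₀ (abs_nonneg _) h1 hn
  linarith [(abs_lt.1 this).2]

theorem gaussProd_pos {q : ℝ} (h1 : |q| < 1) (n : ℕ) : 0 < gaussProd q n :=
  Finset.prod_pos fun _ _ => div_pos (one_sub_pow_pos h1 (by omega)) (one_sub_pow_pos h1 (by omega))

theorem gaussProd_succ (q : ℝ) (n : ℕ) : gaussProd q (n + 1) =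
    gaussProd q n * ((1 - q ^ (2 * n + 2)) / (1 - q ^ (2 * n + 1))) :=
  Finset.prod_range_succ _ _

theorem shanks_telescope {q : ℝ} (h1 : |q| < 1) (n m : ℕ) :
    ∑ s ∈ Finset.range m, (gaussProd q (n + 1) / gaussProd q s * q ^ (s * (2 * n + 3)) -
        gaussProd q n / gaussProd q s * q ^ (s * (2 * n + 1))) =
      gaussProd q n / gaussProd q m * (1 - q ^ (2 * m)) * q ^ (m * (2 * n + 1)) /
        (1 - q ^ (2 * n + 1)) := by
  induction m with
  | zero => simp
  | succ m ih =>
    rw [Finset.sum_range_succ, ih, gaussProd_succ, gaussProd_succ]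
    have a1 := (one_sub_pow_pos h1 (n := 2 * n + 1) (by omega)).ne'
    have a2 := (one_sub_pow_pos h1 (n := 2 * m + 1) (by omega)).ne'
    have a3 := (one_sub_pow_pos h1 (n := 2 * m + 2) (by omega)).ne'
    have a4 := (gaussProd_pos h1 n).ne'
    have a5 := (gaussProd_pos h1 m).ne'
    have a6 : 1 - q ^ (2 * (m + 1)) ≠ 0 := a3
    field_simp
    ring

/-- Induction on `n`: by the telescoping lemma, passing to `n + 1` changes the right side by `q ^
(n(2n + 1)) · (1 + q ^ (2n + 1))`, exactly the next two triangular powers. -/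
theorem shanks_identity {q : ℝ} (h1 : |q| < 1) (n : ℕ) :
    ∑ s ∈ Finset.range (2 * n), q ^ (s * (s + 1) / 2) =
      ∑ s ∈ Finset.range n, gaussProd q n / gaussProd q s * q ^ (s * (2 * n + 1)) := by
  induction n with
  | zero => simp
  | succ n ih =>
    have t := shanks_telescope h1 n n
    rw [Finset.sum_sub_distrib] at t
    have e1 : 2 * n * (2 * n + 1) / 2 = n * (2 * n + 1) := by
      rw [mul_assoc, Nat.mul_div_cancel_left _ (by norm_num)]
    have e2 : (2 * n + 1) * (2 * n + 1 + 1) / 2 = (2 * n + 1) * (n + 1) := by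
      rw [show (2 * n + 1) * (2 * n + 1 + 1) = 2 * ((2 * n + 1) * (n + 1)) by ring,
        Nat.mul_div_cancel_left _ (by norm_num)]
    rw [show 2 * (n + 1) = 2 * n + 1 + 1 by ring, Finset.sum_range_succ, Finset.sum_range_succ, ih,
      e1, e2, Finset.sum_range_succ]
    have t' := eq_add_of_sub_eq t
    rw [show 2 * n + 1 + 1 + 1 = 2 * n + 3 by ring, t', gaussProd_succ]
    have a1 := (one_sub_pow_pos h1 (n := 2 * n + 1) (by omega)).ne'
    have a4 := (gaussProd_pos h1 n).ne'
    field_simp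
    ring

/-- `log ∏ (1 - q ^ n)` over `n ≥ 1`. -/
noncomputable def logEuler (q : ℝ) : ℝ := ∑' n : ℕ, log (1 - q ^ (n + 1))

/-- `log ∏ (1 - q ^ n)` over odd `n`. -/
noncomputable def logEulerOdd (q : ℝ) : ℝ := ∑' n : ℕ, log (1 - q ^ (2 * n + 1))

theorem summable_logEuler {q : ℝ} (h1 : |q| < 1) : Summable fun n : ℕ => log (1 - q ^ (n + 1)) := by
  have : Summable fun n : ℕ => ‖-q ^ (n + 1)‖ := by
    simp_rw [norm_neg, norm_pow, pow_succ]
    exact (summable_geometric_of_lt_one (abs_nonneg q) h1).mul_right _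
  simpa [sub_eq_add_neg] using Real.summable_log_one_add_of_summable this.of_norm

theorem summable_logEulerOdd {q : ℝ} (h1 : |q| < 1) :
    Summable fun n : ℕ => log (1 - q ^ (2 * n + 1)) := by
  have hi : Function.Injective fun n : ℕ => 2 * n := mul_right_injective₀ two_ne_zero
  exact (summable_logEuler h1).comp_injective hi

theorem tsum_eq_even_add_odd {f : ℕ → ℝ} (hf : Summable f) :
    ∑' n, f n = ∑' n, f (2 * n) + ∑' n, f (2 * n + 1) := by
  have hi : Function.Injective fun n : ℕ => 2 * n := mul_right_injective₀ two_ne_zero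
  exact (tsum_even_add_odd (hf.comp_injective hi)
    (hf.comp_injective ((add_left_injective 1).comp hi))).symm

theorem logEuler_eq {q : ℝ} (h1 : |q| < 1) :
    logEuler q = logEuler (q ^ 2) + logEulerOdd q := by
  rw [logEuler, tsum_eq_even_add_odd (summable_logEuler h1), add_comm, logEuler, logEulerOdd]
  congr 1
  refine tsum_congr fun n => ?_
  rw [← pow_mul]; ring_nf

theorem logEulerOdd_add_neg {q : ℝ} (h1 : |q| < 1) :
    logEulerOdd q + logEulerOdd (-q) = logEulerOdd (q ^ 2) := by
  have h2 : |-q| < 1 := by rwa [abs_neg]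
  rw [logEulerOdd, logEulerOdd, logEulerOdd,
    ← (summable_logEulerOdd h1).tsum_add (summable_logEulerOdd h2)]
  refine tsum_congr fun n => ?_
  rw [← log_mul (one_sub_pow_pos h1 (by omega)).ne' (one_sub_pow_pos h2 (by omega)).ne',
    Odd.neg_pow ⟨n, rfl⟩]
  congr 1; ring

theorem tendsto_gaussProd {q : ℝ} (h1 : |q| < 1) :
    Tendsto (gaussProd q) atTop (𝓝 (exp (logEuler (q ^ 2) - logEulerOdd q))) := by
  have a := (summable_logEuler (abs_lt_one_sq h1)).hasSum.tendsto_sum_nat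
  have b := (summable_logEulerOdd h1).hasSum.tendsto_sum_nat
  refine ((continuous_exp.tendsto _).comp (a.sub b)).congr fun n => ?_
  rw [Function.comp, ← Finset.sum_sub_distrib, exp_sum, gaussProd]
  refine Finset.prod_congr rfl fun s _ => ?_
  rw [exp_sub, exp_log (one_sub_pow_pos (abs_lt_one_sq h1) (by omega)),
    exp_log (one_sub_pow_pos h1 (by omega)), ← pow_mul]
  ring_nf

/-- In Shanks's identity the term `s = 0` is `gaussProd q n`. The other `n - 1` terms are each
`O(|q| ^ n)`, since the product and its inverse are bounded, and so vanish in the limit. -/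
theorem tendsto_sum_tri {q : ℝ} (h1 : |q| < 1) :
    Tendsto (fun n : ℕ => ∑ s ∈ Finset.range (2 * n), q ^ (s * (s + 1) / 2)) atTop
      (𝓝 (exp (logEuler (q ^ 2) - logEulerOdd q))) := by
  have hp := tendsto_gaussProd h1
  obtain ⟨M, hM⟩ := hp.bddAbove_range
  have hpi := hp.inv₀ (exp_ne_zero _)
  obtain ⟨N, hN⟩ := hpi.bddAbove_range
  have hM0 : 0 ≤ M := (gaussProd_pos h1 0).le.trans (hM ⟨0, rfl⟩)
  have hN0 : 0 ≤ N := (inv_pos.2 (gaussProd_pos h1 0)).le.trans (hN ⟨0, rfl⟩)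
  have key : Tendsto (fun n : ℕ => ∑ s ∈ Finset.range (2 * n), q ^ (s * (s + 1) / 2) -
      gaussProd q n) atTop (𝓝 0) := by
    have hb : Tendsto (fun n : ℕ => M * N * (n * |q| ^ n)) atTop (𝓝 0) := by
      simpa using (tendsto_self_mul_const_pow_of_lt_one (abs_nonneg q) h1).const_mul (M * N)
    refine squeeze_zero_norm' ?_ hb
    filter_upwards [eventually_gt_atTop 0] with n hn
    obtain ⟨m, rfl⟩ := Nat.exists_eq_succ_of_ne_zero hn.ne'
    rw [shanks_identity h1, Finset.sum_range_succ']
    have : gaussProd q 0 = 1 := by simp [gaussProd]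
    simp only [this, div_one, Nat.succ_eq_add_one, zero_mul, pow_zero, mul_one,
      add_sub_cancel_right]
    refine (norm_sum_le _ _).trans ?_
    calc _ ≤ ∑ s ∈ Finset.range m, M * N * |q| ^ (m + 1) := by
          refine Finset.sum_le_sum fun s _ => ?_
          rw [norm_mul, norm_pow, div_eq_mul_inv, norm_mul, norm_inv, norm_eq_abs, norm_eq_abs,
            abs_of_pos (gaussProd_pos h1 _), abs_of_pos (gaussProd_pos h1 _)]
          refine mul_le_mul (mul_le_mul (hM ⟨_, rfl⟩) (hN ⟨_, rfl⟩)
            (inv_pos.2 (gaussProd_pos h1 _)).le hM0) ?_ (by positivity) (by positivity)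
          exact pow_le_pow_of_le_one (abs_nonneg _) h1.le (by nlinarith)
      _ ≤ _ := by
          rw [Finset.sum_const, Finset.card_range, nsmul_eq_mul, mul_left_comm]
          gcongr
          linarith
  simpa using key.add hp

/-- The factor 2 comes from the symmetry `n ↦ -n - 1` of the triangular exponent. -/
theorem thetaTri_eq {q : ℝ} (h0 : q ≠ 0) (h1 : |q| < 1) :
    thetaTri q = 2 * exp (logEuler (q ^ 2) - logEulerOdd q) := by
  have st := (summable_norm_zpow h0 h1 abs_sub_one_le_tri).of_norm
  have e : ∀ n : ℕ, q ^ ((n : ℤ) * (n + 1) / 2) = q ^ (n * (n + 1) / 2) := fun n => by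
    rw [← zpow_natCast]; push_cast; rfl
  have s : Summable fun n : ℕ => q ^ (n * (n + 1) / 2) := by
    refine (st.comp_injective Nat.cast_injective).congr fun n => (e n).symm ▸ rfl
  have hs : ∑' n : ℕ, q ^ (n * (n + 1) / 2) = exp (logEuler (q ^ 2) - logEulerOdd q) := by
    refine tendsto_nhds_unique (s.hasSum.tendsto_sum_nat.comp ?_) (tendsto_sum_tri h1)
    exact tendsto_id.const_mul_atTop' (by norm_num)
  have hh := HasSum.of_nat_of_neg_add_one (f := fun n : ℤ => q ^ (n * (n + 1) / 2))
    (m := exp (logEuler (q ^ 2) - logEulerOdd q)) (m' := exp (logEuler (q ^ 2) - logEulerOdd q))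
    (by simp only [e]; exact hs ▸ s.hasSum) (by
      have : ∀ n : ℕ, q ^ ((-((n : ℤ) + 1)) * (-((n : ℤ) + 1) + 1) / 2) = q ^ (n * (n + 1) / 2) :=
        fun n => by rw [← e]; congr 2; ring
      simp only [this]; exact hs ▸ s.hasSum)
  rw [thetaTri, hh.tsum_eq, two_mul]

/-! ### Jacobi's theta identities and behaviour at zero -/

theorem thetaTri_pos {q : ℝ} (h0 : q ≠ 0) (h1 : |q| < 1) : 0 < thetaTri q := by
  rw [thetaTri_eq h0 h1]; positivity

theorem thetaSq_eq {q : ℝ} (h0 : q ≠ 0) (h1 : |q| < 1) :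
    thetaSq q = thetaTri q ^ 2 / (2 * thetaTri (q ^ 2)) := by
  have := (thetaTri_pos (pow_ne_zero 2 h0) (abs_lt_one_sq h1)).ne'
  rw [thetaTri_sq h0 h1]; field_simp

theorem thetaSq_pos {q : ℝ} (h0 : q ≠ 0) (h1 : |q| < 1) : 0 < thetaSq q := by
  have h2 := thetaTri_pos (pow_ne_zero 2 h0) (abs_lt_one_sq h1)
  have := thetaTri_pos h0 h1
  rw [thetaSq_eq h0 h1]; positivity

theorem thetaSq_neg_sq {q : ℝ} (h0 : q ≠ 0) (h1 : |q| < 1) :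
    thetaSq (-q) ^ 2 = thetaSq (q ^ 2) ^ 2 - q * thetaTri (q ^ 4) ^ 2 := by
  have h := thetaSq_sq (neg_ne_zero.2 h0) (by rwa [abs_neg])
  rw [neg_sq, Even.neg_pow (by decide)] at h
  rw [h]; ring

/-- Jacobi's quartic identity: the difference of the squares of `thetaSq_sq` at `q` and `-q`, with
the cross term rewritten by `thetaTri_sq`. It becomes `k² + k'² = 1`. -/
theorem thetaSq_pow_four {q : ℝ} (h0 : q ≠ 0) (h1 : |q| < 1) :
    thetaSq q ^ 4 = thetaSq (-q) ^ 4 + q * thetaTri (q ^ 2) ^ 4 := by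
  have a := thetaSq_sq h0 h1
  have b := thetaSq_neg_sq h0 h1
  have c := thetaTri_sq (pow_ne_zero 2 h0) (abs_lt_one_sq h1)
  rw [← pow_mul] at c
  calc thetaSq q ^ 4 = (thetaSq q ^ 2) ^ 2 := by ring
    _ = (thetaSq (-q) ^ 2) ^ 2 + q * (thetaTri (q ^ 2) ^ 2) ^ 2 := by rw [a, b, c]; ring
    _ = _ := by ring

/-- The geometric-mean half of the AGM step: multiplying `thetaSq_sq` at `q` and `-q` gives a
difference of fourth powers, evaluated by the quartic identity at `q²`. -/
theorem thetaSq_mul_neg {q : ℝ} (h0 : q ≠ 0) (h1 : |q| < 1) :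
    thetaSq q * thetaSq (-q) = thetaSq (-q ^ 2) ^ 2 := by
  have p1 := thetaSq_pos h0 h1
  have p2 := thetaSq_pos (neg_ne_zero.2 h0) (by rwa [abs_neg])
  refine (sq_eq_sq₀ (by positivity) (by positivity)).1 ?_
  have c := thetaSq_pow_four (pow_ne_zero 2 h0) (abs_lt_one_sq h1)
  rw [← pow_mul] at c
  rw [mul_pow, thetaSq_sq h0 h1, thetaSq_neg_sq h0 h1]
  norm_num at c
  linear_combination c

theorem thetaSq_mul_thetaSq_neg_mul_thetaTri {q : ℝ} (h0 : q ≠ 0) (h1 : |q| < 1) :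
    thetaSq q * thetaSq (-q) * thetaTri (q ^ 2) = 2 * exp (logEuler (q ^ 2)) ^ 3 := by
  have h1n : |-q| < 1 := by rwa [abs_neg]
  have h2 := abs_lt_one_sq h1
  have q2 := pow_ne_zero 2 h0
  have e1 := logEuler_eq h2
  have e2 := logEulerOdd_add_neg h1
  rw [thetaSq_eq h0 h1, thetaSq_eq (neg_ne_zero.2 h0) h1n, neg_sq, thetaTri_eq h0 h1,
    thetaTri_eq (neg_ne_zero.2 h0) h1n, thetaTri_eq q2 h2, neg_sq]
  set A := logEuler (q ^ 2)
  set B := logEulerOdd q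
  set C := logEulerOdd (-q)
  set D := logEuler ((q ^ 2) ^ 2)
  have : 2 * exp A ^ 3 =
      2 * (exp (A - B) ^ 2 * exp (A - C) ^ 2 / exp (D - logEulerOdd (q ^ 2))) := by
    rw [← exp_nat_mul, ← exp_nat_mul, ← exp_nat_mul, ← exp_add, ← exp_sub]
    congr 2
    push_cast
    linarith
  rw [this]
  field_simp

theorem two_mul_thetaSq_neg_sq_div {q : ℝ} (h0 : q ≠ 0) (h1 : |q| < 1) :
    2 * thetaSq (-q) ^ 2 / (thetaSq q * thetaTri (q ^ 2)) = exp (logEulerOdd q) ^ 6 := by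
  have h1n : |-q| < 1 := by rwa [abs_neg]
  have h2 := abs_lt_one_sq h1
  have q2 := pow_ne_zero 2 h0
  have e1 := logEuler_eq h2
  have e2 := logEulerOdd_add_neg h1
  rw [thetaSq_eq h0 h1, thetaSq_eq (neg_ne_zero.2 h0) h1n, neg_sq, thetaTri_eq h0 h1,
    thetaTri_eq (neg_ne_zero.2 h0) h1n, thetaTri_eq q2 h2, neg_sq]
  set A := logEuler (q ^ 2)
  set B := logEulerOdd q
  set C := logEulerOdd (-q)
  set D := logEuler ((q ^ 2) ^ 2)
  have : exp B ^ 6 = exp (A - C) ^ 4 / (exp (D - logEulerOdd (q ^ 2)) ^ 2 * exp (A - B) ^ 2) := by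
    rw [← exp_nat_mul, ← exp_nat_mul, ← exp_nat_mul, ← exp_nat_mul, ← exp_add, ← exp_sub]
    congr 1
    push_cast
    linarith
  rw [this]
  field_simp

theorem tendsto_thetaSq_zero : Tendsto thetaSq (𝓝 0) (𝓝 1) := by
  have hl : ∑' n : ℤ, (0 : ℝ) ^ (n ^ 2 : ℤ) = 1 := by
    -- At `q = 0` only `n = 0` survives, because `0 ^ 0 = 1`.
    rw [tsum_eq_single 0]
    · simp
    · intro n hn
      exact zero_zpow _ (pow_ne_zero 2 hn)
  rw [← hl]
  have hs := summable_norm_zpow (q := 1 / 2) (by norm_num) (by norm_num [abs_of_pos])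
    abs_sub_one_le_sq
  refine tendsto_tsum_of_dominated_convergence hs (fun n => ?_) ?_
  · exact continuousAt_zpow₀ _ _ (Or.inr (sq_nonneg n))
  · filter_upwards [Metric.ball_mem_nhds (0 : ℝ) (by norm_num : (0 : ℝ) < 1 / 2)] with q hq n
    rw [norm_zpow, norm_zpow]
    refine zpow_le_zpow_left₀ (sq_nonneg n) (norm_nonneg _) ?_
    rw [mem_ball_zero_iff] at hq
    simpa using hq.le

/-- The Poisson summation formula for `thetaSq`. -/
theorem thetaSq_exp_inv {α : ℝ} (hα : 0 < α) :
    thetaSq (exp (-π / α)) = √α * thetaSq (exp (-π * α)) := by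
  have h := Real.tsum_exp_neg_mul_int_sq hα
  have e : ∀ b : ℝ, thetaSq (exp b) = ∑' n : ℤ, exp (b * (n : ℝ) ^ 2) := fun b => by
    refine tsum_congr fun n => ?_
    rw [← rpow_intCast, ← exp_mul]
    congr 1; push_cast; ring
  rw [e, e, h, sqrt_eq_rpow, ← mul_assoc, mul_one_div_cancel (rpow_pos_of_pos hα _).ne', one_mul]

/-! ### The elliptic integral and the arithmetic-geometric mean -/

/-- The symmetric form of the complete elliptic integral of the first kind. -/
noncomputable def ellipticI (a b : ℝ) : ℝ :=
  ∫ φ in (0 : ℝ)..(π / 2), 1 / √(a ^ 2 * cos φ ^ 2 + b ^ 2 * sin φ ^ 2)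

theorem image_mul_tan {b : ℝ} (hb : 0 < b) :
    (fun φ => b * tan φ) '' Set.Ioo 0 (π / 2) = Set.Ioi 0 := by
  ext t
  constructor
  · rintro ⟨φ, hφ, rfl⟩
    exact mul_pos hb (tan_pos_of_pos_of_lt_pi_div_two hφ.1 hφ.2)
  · intro ht
    have h : 0 < t / b := div_pos ht hb
    refine ⟨arctan (t / b), ⟨by simpa using arctan_strictMono h, arctan_lt_pi_div_two _⟩, ?_⟩
    simp only [tan_arctan]
    field_simp

theorem ellipticI_eq_integral_Ioi {a b : ℝ} (hb : 0 < b) :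
    ellipticI a b = ∫ t in Set.Ioi (0 : ℝ), 1 / √((a ^ 2 + t ^ 2) * (b ^ 2 + t ^ 2)) := by
  have hc : ∀ φ ∈ Set.Ioo (0 : ℝ) (π / 2), 0 < cos φ := fun φ hφ =>
    cos_pos_of_mem_Ioo ⟨by linarith [hφ.1, pi_pos], hφ.2⟩
  have h := MeasureTheory.integral_image_eq_integral_abs_deriv_smul (s := Set.Ioo (0 : ℝ) (π / 2))
    (f := fun φ => b * tan φ) (f' := fun φ => b * (1 / cos φ ^ 2)) measurableSet_Ioo
    (fun φ hφ => ((hasDerivAt_tan (hc φ hφ).ne').const_mul b).hasDerivWithinAt)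
    (fun x hx y hy hxy => by
      have hxy' : tan x = tan y := mul_left_cancel₀ hb.ne' hxy
      exact tan_inj_of_lt_of_lt_pi_div_two (by linarith [hx.1, pi_pos]) hx.2
        (by linarith [hy.1, pi_pos]) hy.2 hxy')
    (fun t => 1 / √((a ^ 2 + t ^ 2) * (b ^ 2 + t ^ 2)))
  rw [image_mul_tan hb] at h
  rw [h, ellipticI, intervalIntegral.integral_of_le (by positivity),
    MeasureTheory.integral_Ioc_eq_integral_Ioo]
  refine MeasureTheory.setIntegral_congr_fun measurableSet_Ioo fun φ hφ => ?_
  have c := hc φ hφ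
  have e : (a ^ 2 + (b * tan φ) ^ 2) * (b ^ 2 + (b * tan φ) ^ 2) =
      (a ^ 2 * cos φ ^ 2 + b ^ 2 * sin φ ^ 2) * (b / cos φ ^ 2) ^ 2 := by
    rw [tan_eq_sin_div_cos]
    field_simp
    rw [cos_sq_add_sin_sq]; ring
  simp only [smul_eq_mul]
  rw [e, sqrt_mul (by positivity), sqrt_sq (by positivity), abs_of_pos (by positivity)]
  have hp : 0 < √(a ^ 2 * cos φ ^ 2 + b ^ 2 * sin φ ^ 2) := by
    have := sin_pos_of_pos_of_lt_pi hφ.1 (by linarith [hφ.2, pi_pos])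
    positivity
  field_simp

theorem image_sub_div {c : ℝ} (hc : 0 < c) :
    (fun t : ℝ => (t - c / t) / 2) '' Set.Ioi 0 = Set.univ := by
  refine Set.eq_univ_of_forall fun u => ?_
  have h1 : 0 ≤ u ^ 2 + c := by positivity
  have h2 : |u| < √(u ^ 2 + c) := by
    rw [← sqrt_sq_eq_abs]; exact sqrt_lt_sqrt (sq_nonneg _) (by linarith)
  have h3 : 0 < u + √(u ^ 2 + c) := by linarith [neg_abs_le u]
  -- The positive root of `t² - 2ut - c = 0`.
  refine ⟨u + √(u ^ 2 + c), h3, ?_⟩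
  simp only
  field_simp
  linear_combination sq_sqrt h1

/-- After `t = b tan φ`, the substitution `u = (t - ab/t) / 2` maps `(0, ∞)` onto the line, with
`((a + b)/2)² + u² = (a² + t²)(b² + t²) / (4t²)` and `ab + u² = (t + ab/t)² / 4`. Evenness in `u`
absorbs the resulting factor 2. -/
theorem ellipticI_agm {a b : ℝ} (ha : 0 < a) (hb : 0 < b) :
    ellipticI a b = ellipticI ((a + b) / 2) √(a * b) := by
  have hab : 0 < a * b := mul_pos ha hb
  rw [ellipticI_eq_integral_Ioi hb, ellipticI_eq_integral_Ioi (sqrt_pos.2 hab)]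
  set h : ℝ → ℝ := fun t => 1 / √((((a + b) / 2) ^ 2 + t ^ 2) * (√(a * b) ^ 2 + t ^ 2)) with hh
  have h1 : ∫ t, h t = 2 * ∫ t in Set.Ioi (0 : ℝ), h t := by
    rw [← integral_comp_abs]
    simp only [hh, sq_abs]
  have h2 := MeasureTheory.integral_image_eq_integral_abs_deriv_smul (s := Set.Ioi (0 : ℝ))
    (f := fun t => (t - a * b / t) / 2) (f' := fun t => (1 + a * b / t ^ 2) / 2) measurableSet_Ioi
    (fun t ht => by
      have ht' : t ≠ 0 := ne_of_gt ht
      have := ((hasDerivAt_id t).sub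
        ((hasDerivAt_const t (a * b)).div (hasDerivAt_id t) ht')).div_const 2
      refine (this.congr_deriv ?_).hasDerivWithinAt
      simp only [id]
      ring)
    (fun x hx y hy hxy => by
      have hx' : 0 < x := hx
      have hy' : 0 < y := hy
      simp only at hxy
      field_simp at hxy
      have : (x - y) * (x * y + a * b) = 0 := by linear_combination hxy
      rcases mul_eq_zero.1 this with h | h
      · linarith
      · nlinarith [mul_pos hx' hy'])
    h
  rw [image_sub_div hab, MeasureTheory.setIntegral_univ, h1] at h2
  have h3 : ∫ t in Set.Ioi (0 : ℝ), |(1 + a * b / t ^ 2) / 2| • h ((t - a * b / t) / 2) =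
      2 * ∫ t in Set.Ioi (0 : ℝ), 1 / √((a ^ 2 + t ^ 2) * (b ^ 2 + t ^ 2)) := by
    rw [← MeasureTheory.integral_const_mul]
    refine MeasureTheory.setIntegral_congr_fun measurableSet_Ioi fun t ht => ?_
    have ht' : 0 < t := ht
    simp only [hh, smul_eq_mul]
    have e : (((a + b) / 2) ^ 2 + ((t - a * b / t) / 2) ^ 2) *
        (√(a * b) ^ 2 + ((t - a * b / t) / 2) ^ 2) =
        ((a ^ 2 + t ^ 2) * (b ^ 2 + t ^ 2)) * ((1 + a * b / t ^ 2) / 4) ^ 2 := by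
      rw [sq_sqrt hab.le]
      field_simp
      ring
    rw [e, sqrt_mul (by positivity), sqrt_sq (by positivity), abs_of_pos (by positivity)]
    have : 0 < √((a ^ 2 + t ^ 2) * (b ^ 2 + t ^ 2)) := by positivity
    field_simp
    norm_num
  linarith

theorem ellipticI_integrable {a b : ℝ} (ha : 0 < a) (hb : 0 < b) :
    IntervalIntegrable (fun φ => 1 / √(a ^ 2 * cos φ ^ 2 + b ^ 2 * sin φ ^ 2))
      MeasureTheory.volume 0 (π / 2) := by
  refine Continuous.intervalIntegrable ?_ _ _
  refine continuous_const.div (by fun_prop) fun φ => (sqrt_pos.2 ?_).ne'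
  have : 0 < a ^ 2 := by positivity
  have : 0 < b ^ 2 := by positivity
  by_cases h : cos φ = 0
  · have := cos_sq_add_sin_sq φ
    rw [h] at this ⊢
    nlinarith
  · have : 0 < cos φ ^ 2 := by positivity
    positivity

theorem ellipticI_mem_Icc {a b m M : ℝ} (hm : 0 < m) (ha : a ∈ Set.Icc m M)
    (hb : b ∈ Set.Icc m M) : ellipticI a b ∈ Set.Icc (π / (2 * M)) (π / (2 * m)) := by
  have ha0 : 0 < a := hm.trans_le ha.1
  have hb0 : 0 < b := hm.trans_le hb.1
  have hM : 0 < M := ha0.trans_le ha.2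
  have key : ∀ c : ℝ, ∫ φ in (0 : ℝ)..(π / 2), 1 / c = π / (2 * c) := fun c => by
    rw [intervalIntegral.integral_const, smul_eq_mul, sub_zero]
    by_cases h : c = 0
    · simp [h]
    · field_simp
  have hpos : ∀ φ, m ≤ √(a ^ 2 * cos φ ^ 2 + b ^ 2 * sin φ ^ 2) := fun φ => by
    refine le_sqrt_of_sq_le ?_
    have h1 : m ^ 2 ≤ a ^ 2 := pow_le_pow_left₀ hm.le ha.1 2
    have h2 : m ^ 2 ≤ b ^ 2 := pow_le_pow_left₀ hm.le hb.1 2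
    calc m ^ 2 = m ^ 2 * cos φ ^ 2 + m ^ 2 * sin φ ^ 2 := by
          rw [← mul_add, cos_sq_add_sin_sq, mul_one]
      _ ≤ _ := by gcongr
  constructor
  · rw [← key, ellipticI]
    refine intervalIntegral.integral_mono_on (by positivity) (by simp)
      (ellipticI_integrable ha0 hb0) fun φ _ => ?_
    refine one_div_le_one_div_of_le (hm.trans_le (hpos φ)) ?_
    refine sqrt_le_iff.2 ⟨hM.le, ?_⟩
    calc _ ≤ M ^ 2 * cos φ ^ 2 + M ^ 2 * sin φ ^ 2 := by
          gcongr
          exacts [ha.2, hb.2]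
      _ = _ := by rw [← mul_add, cos_sq_add_sin_sq, mul_one]
  · rw [← key m, ellipticI]
    exact intervalIntegral.integral_mono_on (by positivity) (ellipticI_integrable ha0 hb0) (by simp)
      fun φ _ => one_div_le_one_div_of_le hm (hpos φ)

theorem tendsto_ellipticI {a b : ℕ → ℝ} (ha : Tendsto a atTop (𝓝 1)) (hb : Tendsto b atTop (𝓝 1)) :
    Tendsto (fun n => ellipticI (a n) (b n)) atTop (𝓝 (π / 2)) := by
  have h1 := ha.min hb
  have h2 := ha.max hb
  rw [min_self] at h1
  rw [max_self] at h2
  have t : ∀ {c : ℕ → ℝ}, Tendsto c atTop (𝓝 1) →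
      Tendsto (fun n => π / (2 * c n)) atTop (𝓝 (π / 2)) := fun {c} hc => by
    have h := (tendsto_const_nhds (x := π)).div (hc.const_mul 2) (by norm_num)
    rwa [mul_one] at h
  refine tendsto_of_tendsto_of_tendsto_of_le_of_le' (t h2) (t h1) ?_ ?_ <;>
  · filter_upwards [h1.eventually (lt_mem_nhds one_pos)] with n hn
    have := ellipticI_mem_Icc hn (a := a n) (b := b n) ⟨min_le_left _ _, le_max_left _ _⟩
      ⟨min_le_right _ _, le_max_right _ _⟩
    first | exact this.1 | exact this.2

theorem ellipticI_thetaSq_step {q : ℝ} (h0 : q ≠ 0) (h1 : |q| < 1) :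
    ellipticI (thetaSq q ^ 2) (thetaSq (-q) ^ 2) =
      ellipticI (thetaSq (q ^ 2) ^ 2) (thetaSq (-q ^ 2) ^ 2) := by
  have p1 := thetaSq_pos h0 h1
  have p2 := thetaSq_pos (neg_ne_zero.2 h0) (by rwa [abs_neg])
  rw [ellipticI_agm (by positivity) (by positivity), ← mul_pow, sqrt_sq (by positivity),
    thetaSq_mul_neg h0 h1, thetaSq_neg_sq h0 h1, thetaSq_sq h0 h1]
  congr 1; ring

/-- Each AGM step replaces `q` by `q²` and preserves the integral. Along `q ^ 2 ^ n → 0` both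
arguments tend to 1, where the integral is `π / 2`. -/
theorem ellipticI_thetaSq {q : ℝ} (h0 : q ≠ 0) (h1 : |q| < 1) :
    ellipticI (thetaSq q ^ 2) (thetaSq (-q) ^ 2) = π / 2 := by
  have hit : ∀ n : ℕ, ellipticI (thetaSq (q ^ 2 ^ n) ^ 2) (thetaSq (-q ^ 2 ^ n) ^ 2) =
      ellipticI (thetaSq q ^ 2) (thetaSq (-q) ^ 2) := fun n => by
    induction n with
    | zero => simp
    | succ n ih =>
      have h : |q ^ 2 ^ n| < 1 := by
        rw [abs_pow]; exact pow_lt_one₀ (abs_nonneg _) h1 (by positivity)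
      rw [← ih, ellipticI_thetaSq_step (q := q ^ 2 ^ n) (pow_ne_zero _ h0) h, ← pow_mul, ← pow_succ]
  have hq : Tendsto (fun n : ℕ => q ^ 2 ^ n) atTop (𝓝 0) :=
    (tendsto_pow_atTop_nhds_zero_of_abs_lt_one h1).comp
      (tendsto_pow_atTop_atTop_of_one_lt (by norm_num))
  have hn : Tendsto (fun n : ℕ => -q ^ 2 ^ n) atTop (𝓝 0) := by simpa using hq.neg
  have := tendsto_ellipticI (by simpa using (tendsto_thetaSq_zero.comp hq).pow 2)
    (by simpa using (tendsto_thetaSq_zero.comp hn).pow 2)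
  simp only [hit] at this
  exact tendsto_nhds_unique tendsto_const_nhds this

theorem ellipticI_mul {c : ℝ} (hc : 0 < c) (a b : ℝ) :
    ellipticI (c * a) (c * b) = ellipticI a b / c := by
  rw [ellipticI, ellipticI, ← intervalIntegral.integral_div]
  refine intervalIntegral.integral_congr fun φ _ => ?_
  rw [show (c * a) ^ 2 * cos φ ^ 2 + (c * b) ^ 2 * sin φ ^ 2 =
    c ^ 2 * (a ^ 2 * cos φ ^ 2 + b ^ 2 * sin φ ^ 2) by ring, sqrt_mul (sq_nonneg c), sqrt_sq hc.le,
    div_div, mul_comm]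

theorem ellipticK_eq_ellipticI {k : ℝ} (hk : k ^ 2 ≤ 1) :
    ellipticK k = ellipticI 1 (complModulus k) := by
  refine intervalIntegral.integral_congr fun φ _ => ?_
  simp only [complModulus]
  rw [sq_sqrt (by linarith)]
  congr 2
  linear_combination -cos_sq_add_sin_sq φ

/-! ### The modulus as a function of the nome -/

/-- The modulus belonging to the nome `q`. -/
noncomputable def modulusOfNome (q : ℝ) : ℝ := √q * thetaTri (q ^ 2) ^ 2 / thetaSq q ^ 2

theorem complModulus_modulusOfNome {q : ℝ} (h0 : 0 < q) (h1 : q < 1) :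
    complModulus (modulusOfNome q) = thetaSq (-q) ^ 2 / thetaSq q ^ 2 := by
  have h1' : |q| < 1 := by rwa [abs_of_pos h0]
  have p1 := thetaSq_pos h0.ne' h1'
  have h := thetaSq_pow_four h0.ne' h1'
  rw [complModulus, modulusOfNome]
  refine (sqrt_eq_iff_mul_self_eq ?_ (by positivity)).2 ?_
  · rw [div_pow, mul_pow, sq_sqrt h0.le, sub_nonneg, div_le_one (by positivity)]
    nlinarith [sq_nonneg (thetaSq (-q) ^ 2)]
  · rw [div_pow, mul_pow, sq_sqrt h0.le]
    field_simp
    linear_combination h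

theorem modulusOfNome_mem {q : ℝ} (h0 : 0 < q) (h1 : q < 1) :
    modulusOfNome q ∈ Set.Ioo (0 : ℝ) 1 := by
  have h1' : |q| < 1 := by rwa [abs_of_pos h0]
  have p1 := thetaSq_pos h0.ne' h1'
  have p2 := thetaSq_pos (neg_ne_zero.2 h0.ne') (by rwa [abs_neg])
  have p3 := thetaTri_pos (pow_ne_zero 2 h0.ne') (abs_lt_one_sq h1')
  have hp : 0 < modulusOfNome q := by rw [modulusOfNome]; positivity
  refine ⟨hp, ?_⟩
  have h : 0 < complModulus (modulusOfNome q) := by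
    rw [complModulus_modulusOfNome h0 h1]; positivity
  have := sqrt_pos.1 h
  nlinarith

theorem ellipticK_modulusOfNome {q : ℝ} (h0 : 0 < q) (h1 : q < 1) :
    ellipticK (modulusOfNome q) = π / 2 * thetaSq q ^ 2 := by
  have h1' : |q| < 1 := by rwa [abs_of_pos h0]
  have p1 := thetaSq_pos h0.ne' h1'
  obtain ⟨m0, m1⟩ := modulusOfNome_mem h0 h1
  rw [ellipticK_eq_ellipticI (by nlinarith), complModulus_modulusOfNome h0 h1,
    ← ellipticI_thetaSq h0.ne' h1']
  have := ellipticI_mul (c := thetaSq q ^ 2) (by positivity) 1 (thetaSq (-q) ^ 2 / thetaSq q ^ 2)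
  rw [mul_one, mul_div_cancel₀ _ (by positivity)] at this
  rw [this]
  field_simp

/-- Inverting `α` exchanges `k` and `k'`. Poisson summation at `α` and `2α` turns `thetaSq_sq` at
`exp (-π / (2α))` into a relation at `q = exp (-πα)`, which is compared with `thetaSq q ^ 2 +
thetaSq (-q) ^ 2 = 2 thetaSq (q²) ^ 2`. -/
theorem complModulus_modulusOfNome_exp {α : ℝ} (hα : 0 < α) :
    complModulus (modulusOfNome (exp (-π * α))) = modulusOfNome (exp (-π / α)) := by
  have q1 : exp (-π * α) < 1 := exp_lt_one_iff.2 (by nlinarith [mul_pos pi_pos hα])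
  have q2 : exp (-π / (2 * α)) < 1 := exp_lt_one_iff.2 (by
    rw [neg_div]; exact neg_lt_zero.2 (by positivity))
  have f1 := thetaSq_exp_inv hα
  have f2 := thetaSq_exp_inv (α := 2 * α) (by positivity)
  have p1 := thetaSq_pos (exp_pos (-π * α)).ne' (by rwa [abs_of_pos (exp_pos _)])
  rw [complModulus_modulusOfNome (exp_pos _) q1, modulusOfNome, f1]
  have a := thetaSq_sq (exp_pos (-π * α)).ne' (by rwa [abs_of_pos (exp_pos _)])
  have b := thetaSq_neg_sq (exp_pos (-π * α)).ne' (by rwa [abs_of_pos (exp_pos _)])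
  have c := thetaSq_sq (exp_pos (-π / (2 * α))).ne' (by rwa [abs_of_pos (exp_pos _)])
  have e1 : exp (-π / (2 * α)) ^ 2 = exp (-π / α) := by
    rw [← exp_nat_mul]; congr 1; push_cast; field_simp
  have e2 : exp (-π * (2 * α)) = exp (-π * α) ^ 2 := by
    rw [← exp_nat_mul]; congr 1; push_cast; ring
  have e3 : √(exp (-π / α)) = exp (-π / (2 * α)) := by
    rw [← e1, sqrt_sq (exp_pos _).le]
  have e4 : exp (-π / (2 * α)) ^ 4 = exp (-π / α) ^ 2 := by
    rw [← e1, ← pow_mul]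
  rw [f2, e1, f1, e2, e4, mul_pow, mul_pow, sq_sqrt (by positivity), sq_sqrt (by positivity)] at c
  rw [e3, mul_pow, sq_sqrt hα.le, div_eq_div_iff (by positivity) (by positivity)]
  linear_combination thetaSq (exp (-π * α)) ^ 2 * (α * b + c + α * a)

theorem ellipticK_complModulus_div {α : ℝ} (hα : 0 < α) :
    ellipticK (complModulus (modulusOfNome (exp (-π * α)))) /
      ellipticK (modulusOfNome (exp (-π * α))) = α := by
  have q1 : exp (-π * α) < 1 := exp_lt_one_iff.2 (by nlinarith [mul_pos pi_pos hα])
  have q2 : exp (-π / α) < 1 := exp_lt_one_iff.2 (by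
    rw [neg_div]; exact neg_lt_zero.2 (by positivity))
  have p1 := thetaSq_pos (exp_pos (-π * α)).ne' (by rwa [abs_of_pos (exp_pos _)])
  rw [complModulus_modulusOfNome_exp hα, ellipticK_modulusOfNome (exp_pos _) q1,
    ellipticK_modulusOfNome (exp_pos _) q2, thetaSq_exp_inv hα, mul_pow, sq_sqrt hα.le]
  generalize thetaSq (exp (-π * α)) = x at p1 ⊢
  have := pi_pos
  field_simp

/-! ### Uniqueness of the modulus -/

theorem one_sub_mul_sin_sq_pos {k : ℝ} (hk : k ∈ Set.Ioo (0 : ℝ) 1) (φ : ℝ) :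
    0 < 1 - k ^ 2 * sin φ ^ 2 := by
  obtain ⟨h0, h1⟩ := hk
  have : k ^ 2 < 1 := by nlinarith
  nlinarith [sin_sq_le_one φ, sq_nonneg (sin φ)]

theorem continuous_ellipticK_integrand {k : ℝ} (hk : k ∈ Set.Ioo (0 : ℝ) 1) :
    Continuous fun φ => 1 / √(1 - k ^ 2 * sin φ ^ 2) :=
  continuous_const.div (by fun_prop) fun φ => (sqrt_pos.2 (one_sub_mul_sin_sq_pos hk φ)).ne'

theorem strictMonoOn_ellipticK : StrictMonoOn ellipticK (Set.Ioo 0 1) := by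
  intro k hk l hl hkl
  have hsq : k ^ 2 < l ^ 2 := pow_lt_pow_left₀ hkl hk.1.le (by norm_num)
  refine intervalIntegral.integral_lt_integral_of_continuousOn_of_le_of_exists_lt (by positivity)
    (continuous_ellipticK_integrand hk).continuousOn
    (continuous_ellipticK_integrand hl).continuousOn (fun φ _ => ?_)
    -- Strictness at one point suffices for continuous integrands; at `π / 2` the sine is 1.
    ⟨π / 2, ⟨by positivity, le_rfl⟩, ?_⟩
  · refine one_div_le_one_div_of_le (sqrt_pos.2 (one_sub_mul_sin_sq_pos hl φ)) (sqrt_le_sqrt ?_)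
    nlinarith [sq_nonneg (sin φ)]
  · refine one_div_lt_one_div_of_lt (sqrt_pos.2 (one_sub_mul_sin_sq_pos hl _))
      (sqrt_lt_sqrt (one_sub_mul_sin_sq_pos hl _).le ?_)
    simpa using hsq

theorem ellipticK_pos {k : ℝ} (hk : k ∈ Set.Ioo (0 : ℝ) 1) : 0 < ellipticK k :=
  intervalIntegral.intervalIntegral_pos_of_pos_on
    ((continuous_ellipticK_integrand hk).intervalIntegrable _ _)
    (fun φ _ => one_div_pos.2 (sqrt_pos.2 (one_sub_mul_sin_sq_pos hk φ))) (by positivity)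

theorem complModulus_mem {k : ℝ} (hk : k ∈ Set.Ioo (0 : ℝ) 1) :
    complModulus k ∈ Set.Ioo (0 : ℝ) 1 := by
  obtain ⟨h0, h1⟩ := hk
  refine ⟨sqrt_pos.2 (by nlinarith), ?_⟩
  rw [complModulus, sqrt_lt' one_pos]
  nlinarith

theorem strictAntiOn_ellipticK_ratio :
    StrictAntiOn (fun k => ellipticK (complModulus k) / ellipticK k) (Set.Ioo 0 1) := by
  intro k hk l hl hkl
  refine div_lt_div₀ (strictMonoOn_ellipticK (complModulus_mem hl) (complModulus_mem hk) ?_)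
    (strictMonoOn_ellipticK hk hl hkl).le (ellipticK_pos (complModulus_mem hk)).le
    (ellipticK_pos hk)
  have hsq : k ^ 2 < l ^ 2 := pow_lt_pow_left₀ hkl hk.1.le (by norm_num)
  exact sqrt_lt_sqrt (by nlinarith [hl.1, hl.2]) (by linarith)

theorem eq_modulusOfNome {α : ℝ} (hα : 0 < α) {k : ℝ} (hk : k ∈ Set.Ioo (0 : ℝ) 1)
    (h : ellipticK (complModulus k) / ellipticK k = α) : k = modulusOfNome (exp (-π * α)) := by
  have q1 : exp (-π * α) < 1 := exp_lt_one_iff.2 (by nlinarith [mul_pos pi_pos hα])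
  refine strictAntiOn_ellipticK_ratio.injOn hk (modulusOfNome_mem (exp_pos _) q1) ?_
  rw [h, ellipticK_complModulus_div hα]

/-! ### Moduli as Euler products -/

/-- The product `16 k k' K³ / π³` in terms of the nome. -/
theorem modulus_prod_eq {q : ℝ} (h0 : 0 < q) (h1 : q < 1) :
    16 * modulusOfNome q * complModulus (modulusOfNome q) *
        ellipticK (modulusOfNome q) ^ 3 / π ^ 3 =
      8 * √q * exp (logEuler (q ^ 2)) ^ 6 := by
  have h1' : |q| < 1 := by rwa [abs_of_pos h0]
  have p1 := thetaSq_pos h0.ne' h1'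
  have h := thetaSq_mul_thetaSq_neg_mul_thetaTri h0.ne' h1'
  rw [complModulus_modulusOfNome h0 h1, ellipticK_modulusOfNome h0 h1, modulusOfNome]
  -- The left side is `2√q` times the square of `thetaSq q * thetaSq (-q) * thetaTri (q ^ 2)`.
  have e : 8 * √q * exp (logEuler (q ^ 2)) ^ 6 = 2 * √q * (2 * exp (logEuler (q ^ 2)) ^ 3) ^ 2 := by
    ring
  rw [e, ← h]
  have := pi_pos
  field_simp
  ring

/-- The quotient `4 √k / k'` in terms of the nome. -/
theorem modulus_quot_eq {q : ℝ} (h0 : 0 < q) (h1 : q < 1) :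
    4 * √(modulusOfNome q) / complModulus (modulusOfNome q) =
      8 * √√q / exp (logEulerOdd q) ^ 6 := by
  have h1' : |q| < 1 := by rwa [abs_of_pos h0]
  have p1 := thetaSq_pos h0.ne' h1'
  have p2 := thetaSq_pos (neg_ne_zero.2 h0.ne') (by rwa [abs_neg])
  have p3 := thetaTri_pos (pow_ne_zero 2 h0.ne') (abs_lt_one_sq h1')
  rw [complModulus_modulusOfNome h0 h1, ← two_mul_thetaSq_neg_sq_div h0.ne' h1', modulusOfNome,
    sqrt_div' _ (by positivity), sqrt_mul (sqrt_nonneg _), sqrt_sq p3.le, sqrt_sq p1.le]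
  field_simp
  norm_num

/-! ### Jensen's formula up to the unit circle -/

-- Jensen's formula holds on each circle of radius `r < 1`, where only finitely many zeros count;
-- then `r → 1`. The limit permits infinitely many simple zeros accumulating at the boundary and
-- asks nothing of `f` there.
open Metric MeromorphicOn in
theorem tendsto_circleAverage_log_norm {f g : ℂ → ℂ} {m : ℕ} {ζ : ℕ → ℂ}
    (hf : AnalyticOnNhd ℂ f (ball 0 1)) (hg : AnalyticAt ℂ g 0) (hg0 : g 0 ≠ 0)
    (hfg : ∀ᶠ z in 𝓝 0, f z = z ^ m * g z) (hinj : Function.Injective ζ)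
    (hζ : ∀ n, ζ n ∈ ball (0 : ℂ) 1) (hζ0 : ∀ n, ζ n ≠ 0) (hfζ : ∀ n, f (ζ n) = 0)
    (hfζ' : ∀ n, deriv f (ζ n) ≠ 0)
    (hzero : ∀ z ∈ ball (0 : ℂ) 1, z ≠ 0 → f z = 0 → z ∈ Set.range ζ)
    (hs : Summable fun n => -log ‖ζ n‖) :
    Tendsto (fun r => circleAverage (fun z => log ‖f z‖) 0 r) (𝓝[<] 1)
      (𝓝 (∑' n, -log ‖ζ n‖ + log ‖g 0‖)) := by
  have key : ∀ r ∈ Set.Ioo (0 : ℝ) 1, circleAverage (fun z => log ‖f z‖) 0 r =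
      ∑' n, (if ‖ζ n‖ ≤ r then log (r * ‖ζ n‖⁻¹) else 0) + m * log r + log ‖g 0‖ := by
    intro r hr
    have hsub : closedBall (0 : ℂ) |r| ⊆ ball 0 1 :=
      closedBall_subset_ball (by rw [abs_of_pos hr.1]; exact hr.2)
    have hfr := hf.mono hsub
    have h0 : (0 : ℂ) ∈ closedBall (0 : ℂ) |r| := by simp
    rw [circleAverage_log_norm hr.1.ne' hfr.meromorphicOn]
    have c1 : meromorphicTrailingCoeffAt f 0 = g 0 := by
      refine hg.meromorphicTrailingCoeffAt_of_ne_zero_of_eq_nhdsNE (n := m) hg0 ?_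
      filter_upwards [hfg.filter_mono nhdsWithin_le_nhds] with z hz
      simp [hz]
    have c2 : divisor f (closedBall (0 : ℂ) |r|) 0 = m := by
      have ho : analyticOrderAt f 0 = m := by
        refine (hfr 0 h0).analyticOrderAt_eq_natCast.2 ⟨g, hg, hg0, ?_⟩
        filter_upwards [hfg] with z hz
        simp [hz]
      rw [hfr.divisor_apply h0, ho]
      simp
    rw [c1, c2]
    have hfin := (divisor f (closedBall (0 : ℂ) |r|)).finiteSupport (isCompact_closedBall 0 |r|)
    set S : ℂ → ℝ := fun u => divisor f (closedBall (0 : ℂ) |r|) u * log (r * ‖0 - u‖⁻¹) with hS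
    have hSfin : S.support.Finite := hfin.subset fun u hu => by
      intro h
      exact hu (by simp [hS, h])
    have hSr : S.support ⊆ Set.range ζ := by
      intro u hu
      have h1 : u ≠ 0 := by rintro rfl; exact hu (by simp [hS])
      have h2 : divisor f (closedBall (0 : ℂ) |r|) u ≠ 0 := by
        intro h; exact hu (by simp [hS, h])
      have h3 : u ∈ closedBall (0 : ℂ) |r| :=
        (divisor f (closedBall (0 : ℂ) |r|)).supportWithinDomain h2
      refine hzero u (hsub h3) h1 ?_
      by_contra h4
      rw [hfr.divisor_apply h3, (hfr u h3).analyticOrderAt_eq_zero.2 h4] at h2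
      simp at h2
    have : ∑ᶠ u, S u = ∑' n, (if ‖ζ n‖ ≤ r then log (r * ‖ζ n‖⁻¹) else 0) := by
      rw [← tsum_eq_finsum (L := SummationFilter.unconditional ℂ) hSfin, ← hinj.tsum_eq hSr]
      refine tsum_congr fun n => ?_
      split_ifs with h
      · have hm : ζ n ∈ closedBall (0 : ℂ) |r| := by
          rw [mem_closedBall_zero_iff, abs_of_pos hr.1]; exact h
        simp only [hS]
        rw [hfr.divisor_apply hm,
          (hfr _ hm).analyticOrderAt_eq_one_of_zero_deriv_ne_zero (hfζ n) (hfζ' n)]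
        simp
      · have hm : ζ n ∉ closedBall (0 : ℂ) |r| := by
          rw [mem_closedBall_zero_iff, abs_of_pos hr.1]; exact h
        have : divisor f (closedBall (0 : ℂ) |r|) (ζ n) = 0 := by
          by_contra h2
          exact hm ((divisor f (closedBall (0 : ℂ) |r|)).supportWithinDomain h2)
        simp [hS, this]
    rw [this]
    simp
  have hIoo : Set.Ioo (0 : ℝ) 1 ∈ 𝓝[<] (1 : ℝ) := Ioo_mem_nhdsLT one_pos
  have hlog : Tendsto (fun r : ℝ => (m : ℝ) * log r) (𝓝[<] 1) (𝓝 0) := by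
    have : Tendsto log (𝓝[<] 1) (𝓝 0) := by
      simpa using (continuousAt_log one_ne_zero).tendsto.mono_left nhdsWithin_le_nhds
    simpa using this.const_mul (m : ℝ)
  have hsum : Tendsto (fun r : ℝ => ∑' n, (if ‖ζ n‖ ≤ r then log (r * ‖ζ n‖⁻¹) else 0)) (𝓝[<] 1)
      (𝓝 (∑' n, -log ‖ζ n‖)) := by
    -- Since `r < 1`, each term `log (r / ‖ζ n‖)` that occurs is at most `-log ‖ζ n‖`.
    refine tendsto_tsum_of_dominated_convergence hs (fun n => ?_) ?_
    · have hp : 0 < ‖ζ n‖ := norm_pos_iff.2 (hζ0 n)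
      have hlt : ‖ζ n‖ < 1 := mem_ball_zero_iff.1 (hζ n)
      have : Tendsto (fun r : ℝ => log (r * ‖ζ n‖⁻¹)) (𝓝[<] 1) (𝓝 (-log ‖ζ n‖)) := by
        have h : ContinuousAt (fun r : ℝ => log (r * ‖ζ n‖⁻¹)) 1 :=
          ContinuousAt.log (by fun_prop) (by simpa using hp.ne')
        simpa using h.tendsto.mono_left nhdsWithin_le_nhds
      refine this.congr' ?_
      filter_upwards [Ioo_mem_nhdsLT hlt] with r hr
      rw [if_pos hr.1.le]
    · filter_upwards [hIoo] with r hr n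
      have hp : 0 < ‖ζ n‖ := norm_pos_iff.2 (hζ0 n)
      have hlt : ‖ζ n‖ < 1 := mem_ball_zero_iff.1 (hζ n)
      split_ifs with h
      · rw [← div_eq_mul_inv, norm_eq_abs, abs_of_nonneg (log_nonneg ((one_le_div hp).2 h)),
          log_div hr.1.ne' hp.ne']
        linarith [log_nonpos hr.1.le hr.2.le]
      · rw [norm_zero]
        linarith [log_nonpos hp.le hlt.le]
  have := (hsum.add hlog).add_const (log ‖g 0‖)
  rw [add_zero] at this
  refine this.congr' ?_
  filter_upwards [hIoo] with r hr
  exact (key r hr).symm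

/-! ### Sine and cosine of the logarithm on the unit circle -/

theorem norm_sin_sq (u : ℂ) : ‖Complex.sin u‖ ^ 2 = (cosh (2 * u.im) - cos (2 * u.re)) / 2 := by
  rw [Complex.sin_eq, Complex.sq_norm, Complex.normSq_apply, cosh_two_mul, cos_two_mul]
  simp only [← Complex.ofReal_sin, ← Complex.ofReal_cos, ← Complex.ofReal_sinh,
    ← Complex.ofReal_cosh, ← Complex.ofReal_mul, Complex.add_re, Complex.add_im,
    Complex.re_ofReal_mul, Complex.im_ofReal_mul, Complex.ofReal_re,
    Complex.ofReal_im, Complex.I_re, Complex.I_im]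
  have h1 := cosh_sq u.im
  have h2 := sin_sq_add_cos_sq u.re
  linear_combination (sin u.re ^ 2 - 1 / 2) * h1 + (sinh u.im ^ 2 + 1) * h2

theorem norm_cos_sq (u : ℂ) : ‖Complex.cos u‖ ^ 2 = (cosh (2 * u.im) + cos (2 * u.re)) / 2 := by
  rw [Complex.cos_eq, Complex.sq_norm, Complex.normSq_apply, cosh_two_mul, cos_two_mul]
  simp only [← Complex.ofReal_sin, ← Complex.ofReal_cos, ← Complex.ofReal_sinh,
    ← Complex.ofReal_cosh, ← Complex.ofReal_mul, Complex.sub_re, Complex.sub_im,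
    Complex.re_ofReal_mul, Complex.im_ofReal_mul, Complex.ofReal_re,
    Complex.ofReal_im, Complex.I_re, Complex.I_im]
  have h1 := cosh_sq u.im
  have h2 := sin_sq_add_cos_sq u.re
  linear_combination (cos u.re ^ 2 - 1 / 2) * h1 + sinh u.im ^ 2 * h2

theorem abs_le_abs_sinh (y : ℝ) : |y| ≤ |sinh y| := by
  rw [abs_sinh]
  exact self_le_sinh_iff.2 (abs_nonneg y)

/-- This lower bound and the upper bound by `cosh u.im` are the only size estimates needed to
control the logarithm near the circle; the cosine satisfies the same ones. -/
theorem abs_im_le_norm_sin (u : ℂ) : |u.im| ≤ ‖Complex.sin u‖ := by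
  refine (abs_le_abs_sinh _).trans (abs_le_of_sq_le_sq ?_ (norm_nonneg _))
  rw [norm_sin_sq, cosh_two_mul, cosh_sq]
  linarith [cos_le_one (2 * u.re)]

theorem abs_im_le_norm_cos (u : ℂ) : |u.im| ≤ ‖Complex.cos u‖ := by
  refine (abs_le_abs_sinh _).trans (abs_le_of_sq_le_sq ?_ (norm_nonneg _))
  rw [norm_cos_sq, cosh_two_mul, cosh_sq]
  linarith [neg_one_le_cos (2 * u.re)]

theorem norm_sin_le (u : ℂ) : ‖Complex.sin u‖ ≤ cosh u.im := by
  refine le_of_sq_le_sq ?_ (cosh_pos _).le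
  rw [norm_sin_sq, cosh_two_mul, sinh_sq]
  linarith [neg_one_le_cos (2 * u.re)]

theorem norm_cos_le (u : ℂ) : ‖Complex.cos u‖ ≤ cosh u.im := by
  refine le_of_sq_le_sq ?_ (cosh_pos _).le
  rw [norm_cos_sq, cosh_two_mul, sinh_sq]
  linarith [cos_le_one (2 * u.re)]

/-- The argument at which `sin` and `cos` are evaluated on the unit disc. -/
noncomputable def discLog (α : ℝ) (z : ℂ) : ℂ := Complex.log (1 + z) / (2 * α)

theorem discLog_im (α : ℝ) (z : ℂ) : (discLog α z).im = (1 + z).arg / (2 * α) := by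
  rw [discLog, show (2 * α : ℂ) = ((2 * α : ℝ) : ℂ) by push_cast; rfl, Complex.div_ofReal_im,
    Complex.log_im]

/-- `|sin arg (1 + z)| = r |sin θ| / |1 + z|` with `r ≥ 1/2` and `|1 + z| ≤ 2`. Uniformity in `r`
yields the integrable majorant `|log (sin θ)| + C` for the limit `r → 1`. -/
theorem abs_sin_div_le_discLog_im {α : ℝ} (hα : 0 < α) {r θ : ℝ} (hr : r ∈ Set.Icc (1 / 2 : ℝ) 1) :
    |sin θ| / (8 * α) ≤ |(discLog α (circleMap 0 r θ)).im| := by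
  obtain ⟨hr0, hr1⟩ := hr
  have hr' : 0 < r := by linarith
  have him : (1 + circleMap 0 r θ).im = r * sin θ := by
    simp [circleMap_zero_im]
  have hn : ‖1 + circleMap 0 r θ‖ ≤ 2 := by
    refine (norm_add_le _ _).trans ?_
    rw [norm_one, norm_circleMap_zero, abs_of_pos hr']; linarith
  rw [discLog_im, abs_div, abs_of_pos (by positivity : 0 < 2 * α)]
  rw [div_le_div_iff₀ (by positivity) (by positivity)]
  have h1 : |sin θ| / 4 ≤ |(1 + circleMap 0 r θ).arg| := by
    rcases eq_or_ne (sin θ) 0 with h | h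
    · rw [h]; simp
    have hpos : 0 < ‖1 + circleMap 0 r θ‖ := by
      rw [norm_pos_iff]; intro h0; rw [h0] at him
      rcases mul_eq_zero.1 him.symm with h' | h'
      exacts [hr'.ne' h', h h']
    refine le_trans ?_ (abs_sin_le_abs)
    rw [Complex.sin_arg, him, abs_div, abs_mul, abs_of_pos hr', abs_of_pos hpos,
      div_le_div_iff₀ (by norm_num) hpos]
    nlinarith [abs_nonneg (sin θ)]
  nlinarith

theorem abs_discLog_im_le {α : ℝ} (hα : 0 < α) (z : ℂ) : |(discLog α z).im| ≤ π / (2 * α) := by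
  rw [discLog_im, abs_div, abs_of_pos (by positivity : 0 < 2 * α)]
  gcongr
  exact Complex.abs_arg_le_pi _

theorem abs_log_norm_comp_discLog_le {F : ℂ → ℂ} (hl : ∀ u, |u.im| ≤ ‖F u‖)
    (hu : ∀ u, ‖F u‖ ≤ cosh u.im) {α : ℝ} (hα : 0 < α) {r θ : ℝ} (hr : r ∈ Set.Icc (1 / 2 : ℝ) 1)
    (hθ : sin θ ≠ 0) :
    |log ‖F (discLog α (circleMap 0 r θ))‖| ≤
      |log (sin θ)| + (|log (8 * α)| + log (cosh (π / (2 * α)))) := by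
  set u := discLog α (circleMap 0 r θ)
  have h1 : |sin θ| / (8 * α) ≤ ‖F u‖ := (abs_sin_div_le_discLog_im hα hr).trans (hl u)
  have h0 : 0 < |sin θ| / (8 * α) := by positivity
  have h2 : ‖F u‖ ≤ cosh (π / (2 * α)) := (hu u).trans (by
    rw [cosh_le_cosh, abs_of_pos (by positivity : 0 < π / (2 * α))]
    exact abs_discLog_im_le hα _)
  have h3 := log_le_log h0 h1
  have h4 := log_le_log (h0.trans_le h1) h2
  have h5 : 0 ≤ log (cosh (π / (2 * α))) := log_nonneg (one_le_cosh _)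
  rw [log_div (abs_ne_zero.2 hθ) (by positivity), log_abs] at h3
  rw [abs_le]
  constructor
  · linarith [neg_abs_le (log (sin θ)), le_abs_self (log (8 * α))]
  · linarith [abs_nonneg (log (sin θ)), abs_nonneg (log (8 * α))]

theorem ae_sin_ne_zero : ∀ᵐ θ : ℝ, sin θ ≠ 0 := by
  have : {θ : ℝ | sin θ = 0}.Countable := by
    have h : {θ : ℝ | sin θ = 0} = Set.range fun n : ℤ => (n : ℝ) * π := by
      ext θ; simp [sin_eq_zero_iff]
    rw [h]; exact Set.countable_range _
  exact this.ae_notMem _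

theorem measurable_log_norm_comp_discLog {F : ℂ → ℂ} (hF : Continuous F) (α r : ℝ) :
    Measurable fun θ => log ‖F (discLog α (circleMap 0 r θ))‖ := by
  refine measurable_log.comp (hF.measurable.comp ?_).norm
  unfold discLog
  refine Measurable.div_const (Complex.measurable_log.comp ?_) _
  exact (continuous_const.add (continuous_circleMap 0 r)).measurable

theorem intervalIntegrable_bound (C a b : ℝ) :
    IntervalIntegrable (fun θ => |log (sin θ)| + C) MeasureTheory.volume a b :=
  (IntervalIntegrable.abs intervalIntegrable_log_sin).add intervalIntegrable_const

theorem circleIntegrable_log_norm_comp_discLog {F : ℂ → ℂ} (hF : Continuous F)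
    (hl : ∀ u, |u.im| ≤ ‖F u‖) (hu : ∀ u, ‖F u‖ ≤ cosh u.im) {α : ℝ} (hα : 0 < α) (a b : ℝ) :
    IntervalIntegrable (fun θ => log ‖F (discLog α (circleMap 0 1 θ))‖)
      MeasureTheory.volume a b := by
  refine (intervalIntegrable_bound (|log (8 * α)| + log (cosh (π / (2 * α)))) a b).mono_fun
    (measurable_log_norm_comp_discLog hF α 1).aestronglyMeasurable ?_
  filter_upwards [MeasureTheory.ae_restrict_of_ae ae_sin_ne_zero] with θ hθ
  refine (abs_log_norm_comp_discLog_le hl hu hα (by norm_num) hθ).trans (le_abs_self _)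

theorem tendsto_circleAverage_comp_discLog {F : ℂ → ℂ} (hF : Continuous F)
    (hl : ∀ u, |u.im| ≤ ‖F u‖) (hu : ∀ u, ‖F u‖ ≤ cosh u.im) {α : ℝ} (hα : 0 < α) :
    Tendsto (fun r => circleAverage (fun z => log ‖F (discLog α z)‖) 0 r) (𝓝[<] 1)
      (𝓝 (circleAverage (fun z => log ‖F (discLog α z)‖) 0 1)) := by
  refine Tendsto.const_smul ?_ _
  refine intervalIntegral.tendsto_integral_filter_of_dominated_convergence
    (fun θ => |log (sin θ)| + (|log (8 * α)| + log (cosh (π / (2 * α))))) ?_ ?_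
    (intervalIntegrable_bound _ _ _) ?_
  · exact Eventually.of_forall fun r =>
      (measurable_log_norm_comp_discLog hF α r).aestronglyMeasurable
  · filter_upwards [Ioo_mem_nhdsLT (by norm_num : (1 / 2 : ℝ) < 1)] with r hr
    filter_upwards [ae_sin_ne_zero] with θ hθ _
    exact abs_log_norm_comp_discLog_le hl hu hα ⟨hr.1.le, hr.2.le⟩ hθ
  · filter_upwards [ae_sin_ne_zero] with θ hθ _
    have h0 : 0 < |sin θ| / (8 * α) := by positivity
    have hpos : F (discLog α (circleMap 0 1 θ)) ≠ 0 := norm_pos_iff.1 <|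
      h0.trans_le ((abs_sin_div_le_discLog_im hα (by norm_num)).trans (hl _))
    have hslit : 1 + circleMap 0 1 θ ∈ Complex.slitPlane := by
      refine Or.inr ?_
      simpa [circleMap_zero_im] using hθ
    have hc : ContinuousAt (fun r : ℝ => log ‖F (discLog α (circleMap 0 r θ))‖) 1 := by
      refine ContinuousAt.log (ContinuousAt.norm (hF.continuousAt.comp ?_))
        (norm_ne_zero_iff.2 hpos)
      unfold discLog
      have h : ContinuousAt (fun r : ℝ => 1 + circleMap 0 r θ) 1 := by
        unfold circleMap; fun_prop
      exact (h.clog hslit).div_const _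
    exact hc.tendsto.mono_left nhdsWithin_le_nhds

theorem discLog_conj {α : ℝ} {z : ℂ} (hz : ‖z‖ ≤ 1) :
    discLog α (starRingEnd ℂ z) = starRingEnd ℂ (discLog α z) := by
  have h : (1 + z).arg ≠ π := by
    intro h
    have := (Complex.arg_eq_pi_iff.1 h).1
    have h2 := (abs_le.1 ((Complex.abs_re_le_norm z).trans hz)).1
    rw [Complex.add_re, Complex.one_re] at this
    linarith
  have e : (1 : ℂ) + starRingEnd ℂ z = starRingEnd ℂ (1 + z) := by simp
  rw [discLog, discLog, e, Complex.log_conj _ h, map_div₀, map_mul, Complex.conj_ofReal,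
    Complex.conj_ofNat]

/-- Setting `θ = 2x` maps `[0, π/2]` to the upper half circle, and conjugation symmetry supplies the
lower half. The endpoint `x = π/2`, where `z = -1`, is a null set. -/
theorem integral_eq_circleAverage {F : ℂ → ℂ} (hF : Continuous F)
    (hl : ∀ u, |u.im| ≤ ‖F u‖) (hu : ∀ u, ‖F u‖ ≤ cosh u.im)
    (hconj : ∀ u, F (starRingEnd ℂ u) = starRingEnd ℂ (F u)) {α : ℝ} (hα : 0 < α) {H : ℝ → ℝ}
    (hH : ∀ x ∈ Set.Ioo 0 (π / 2), H x = log 2 + 2 * log ‖F (discLog α (circleMap 0 1 (2 * x)))‖) :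
    IntervalIntegrable H MeasureTheory.volume 0 (π / 2) ∧
      ∫ x in (0 : ℝ)..(π / 2), H x =
        π / 2 * log 2 + π * circleAverage (fun z => log ‖F (discLog α z)‖) 0 1 := by
  set G : ℝ → ℝ := fun θ => log ‖F (discLog α (circleMap 0 1 θ))‖ with hG
  have hint := circleIntegrable_log_norm_comp_discLog hF hl hu hα
  have hsymm : ∀ θ, G (2 * π - θ) = G θ := fun θ => by
    have : circleMap 0 1 (2 * π - θ) = starRingEnd ℂ (circleMap 0 1 θ) := by
      simp only [circleMap_zero, map_mul, Complex.conj_ofReal, ← Complex.exp_conj, Complex.conj_I]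
      congr 1
      push_cast
      rw [sub_mul, Complex.exp_sub, Complex.exp_two_pi_mul_I, one_div, ← Complex.exp_neg]
      congr 1; ring
    simp only [hG]
    rw [this, discLog_conj (by simp), hconj, Complex.norm_conj]
  have h2pi : ∫ θ in (0 : ℝ)..(2 * π), G θ = 4 * ∫ x in (0 : ℝ)..(π / 2), G (2 * x) := by
    rw [← intervalIntegral.integral_add_adjacent_intervals (hint 0 π) (hint π (2 * π)),
      intervalIntegral.integral_comp_mul_left G two_ne_zero]
    have := intervalIntegral.integral_comp_sub_left (a := 0) (b := π) G (2 * π)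
    simp only [hsymm] at this
    rw [show 2 * π - π = π by ring, sub_zero] at this
    rw [← this, mul_zero, mul_div_cancel₀ _ two_ne_zero, smul_eq_mul]
    ring
  have hint2 : IntervalIntegrable (fun x => G (2 * x)) MeasureTheory.volume 0 (π / 2) := by
    have := (hint 0 π).comp_mul_left (c := 2)
    simpa using this
  have hae : ∀ᵐ x : ℝ, x ∈ Set.uIoc 0 (π / 2) → log 2 + 2 * G (2 * x) = H x := by
    have hne : ∀ᵐ x : ℝ, x ≠ π / 2 := by
      simp [MeasureTheory.ae_iff]
    filter_upwards [hne] with x hx hmem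
    rw [Set.uIoc_of_le (by positivity)] at hmem
    exact (hH x ⟨hmem.1, lt_of_le_of_ne hmem.2 hx⟩).symm
  have hint3 : IntervalIntegrable (fun x => log 2 + 2 * G (2 * x)) MeasureTheory.volume 0 (π / 2) :=
    intervalIntegrable_const.add (hint2.const_mul 2)
  constructor
  · exact hint3.congr_ae ((MeasureTheory.ae_restrict_iff' measurableSet_uIoc).2 hae)
  · rw [← intervalIntegral.integral_congr_ae hae, intervalIntegral.integral_add
      intervalIntegrable_const (hint2.const_mul 2), intervalIntegral.integral_const,
      intervalIntegral.integral_const_mul, circleAverage_def, h2pi]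
    simp only [smul_eq_mul, sub_zero]
    have := pi_pos
    field_simp
    ring

theorem discLog_circleMap {α : ℝ} {x : ℝ} (hx : x ∈ Set.Ioo 0 (π / 2)) :
    discLog α (circleMap 0 1 (2 * x)) = (log (2 * cos x) + x * Complex.I) / (2 * α) := by
  have hc : 0 < cos x := cos_pos_of_mem_Ioo ⟨by linarith [hx.1, pi_pos], hx.2⟩
  have e : 1 + circleMap 0 1 (2 * x) = Complex.exp (log (2 * cos x) + x * Complex.I) := by
    rw [Complex.exp_add, ← Complex.ofReal_exp, exp_log (by positivity), circleMap_zero]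
    push_cast
    rw [Complex.two_cos, add_mul, ← Complex.exp_add, ← Complex.exp_add]
    rw [show -(x : ℂ) * Complex.I + x * Complex.I = 0 by ring, Complex.exp_zero]
    rw [show (x : ℂ) * Complex.I + x * Complex.I = 2 * x * Complex.I by ring]
    ring
  rw [discLog, e, Complex.log_exp]
  · simp; linarith [hx.1, pi_pos]
  · simp; linarith [hx.2, pi_pos]

theorem one_add_mem_slitPlane {z : ℂ} (hz : z ∈ Metric.ball (0 : ℂ) 1) :
    1 + z ∈ Complex.slitPlane :=
  Complex.mem_slitPlane_of_norm_lt_one (mem_ball_zero_iff.1 hz)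

theorem hasDerivAt_discLog (α : ℝ) {z : ℂ} (hz : z ∈ Metric.ball (0 : ℂ) 1) :
    HasDerivAt (discLog α) (1 / (1 + z) / (2 * α)) z :=
  (((hasDerivAt_id z).const_add 1).clog (one_add_mem_slitPlane hz)).div_const _

theorem analyticOnNhd_discLog (α : ℝ) : AnalyticOnNhd ℂ (discLog α) (Metric.ball 0 1) := by
  refine DifferentiableOn.analyticOnNhd (fun z hz => ?_) Metric.isOpen_ball
  exact (hasDerivAt_discLog α hz).differentiableAt.differentiableWithinAt

theorem deriv_discLog_ne_zero {α : ℝ} (hα : 0 < α) {z : ℂ} (hz : z ∈ Metric.ball (0 : ℂ) 1) :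
    1 / (1 + z) / (2 * α : ℂ) ≠ 0 := by
  have h1 : 1 + z ≠ 0 := Complex.slitPlane_ne_zero (one_add_mem_slitPlane hz)
  have h2 : (α : ℂ) ≠ 0 := Complex.ofReal_ne_zero.2 hα.ne'
  exact div_ne_zero (one_div_ne_zero h1) (mul_ne_zero two_ne_zero h2)

/-! ### Zeros in the disc and the circle means -/

/-- The point of the unit disc with `1 + z = exp y`. -/
noncomputable def expPoint (y : ℝ) : ℂ := ((exp y - 1 : ℝ) : ℂ)

theorem norm_expPoint {y : ℝ} (hy : y < 0) : ‖expPoint y‖ = 1 - exp y := by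
  rw [expPoint, Complex.norm_real, norm_eq_abs, abs_of_nonpos] <;> linarith [exp_lt_one_iff.2 hy]

theorem expPoint_mem_ball {y : ℝ} (hy : y < 0) : expPoint y ∈ Metric.ball (0 : ℂ) 1 := by
  rw [mem_ball_zero_iff, norm_expPoint hy]; linarith [exp_pos y]

theorem expPoint_ne_zero {y : ℝ} (hy : y < 0) : expPoint y ≠ 0 := by
  rw [← norm_pos_iff, norm_expPoint hy]; linarith [exp_lt_one_iff.2 hy]

theorem expPoint_injective : Function.Injective expPoint := by
  intro x y h
  have := Complex.ofReal_injective h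
  exact exp_injective (by linarith)

theorem discLog_expPoint (α y : ℝ) : discLog α (expPoint y) = ((y / (2 * α) : ℝ) : ℂ) := by
  rw [discLog, expPoint, ← Complex.ofReal_one, ← Complex.ofReal_add, add_sub_cancel,
    ← Complex.ofReal_log (exp_pos y).le, log_exp]
  push_cast; rfl

/-- Since `|z| < 1` forces `exp y = 1 + z < 2`, the bound `y < log 2` appears; the thresholds on `α`
come from it. -/
theorem eq_expPoint_of_discLog_eq {α : ℝ} (hα : 0 < α) {z : ℂ} (hz : z ∈ Metric.ball (0 : ℂ) 1)
    {y : ℝ} (h : discLog α z = ((y / (2 * α) : ℝ) : ℂ)) : z = expPoint y ∧ y < log 2 := by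
  have hα' : (2 * α : ℂ) ≠ 0 := by simpa using hα.ne'
  have h1 : Complex.log (1 + z) = y := by
    rw [discLog] at h
    push_cast at h
    exact (div_left_inj' hα').1 h
  have h2 : 1 + z = exp y := by
    rw [← Complex.exp_log (Complex.slitPlane_ne_zero (one_add_mem_slitPlane hz)), h1,
      Complex.ofReal_exp]
  have h3 : z = expPoint y := by
    rw [expPoint]; push_cast; rw [Complex.ofReal_exp] at h2; rw [← h2]; ring
  refine ⟨h3, ?_⟩
  rw [lt_log_iff_exp_lt two_pos]
  rw [h3, mem_ball_zero_iff, expPoint, Complex.norm_real, norm_eq_abs] at hz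
  linarith [(abs_lt.1 hz).2]

/-- Zeros satisfy `log (1 + z) = 2παk`. The origin is `k = 0`, and its leading coefficient `1 /
(2α)` gives `-log (2α)`; `k ≥ 1` is excluded by `2πα > log 2`; `k = -(n + 1)` has modulus `1 - q ^
(2n + 2)`. -/
theorem circleAverage_log_norm_sin {α : ℝ} (hα : 0 < α) (hα2 : log 2 / (2 * π) < α) :
    circleAverage (fun z => log ‖Complex.sin (discLog α z)‖) 0 1 =
      -logEuler (exp (-π * α) ^ 2) - log (2 * α) := by
  have hlog : log 2 < 2 * π * α := by rwa [div_lt_iff₀' (by positivity)] at hα2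
  have hα' : (α : ℂ) ≠ 0 := Complex.ofReal_ne_zero.2 hα.ne'
  set f : ℂ → ℂ := fun z => Complex.sin (discLog α z) with hf_def
  have hf : AnalyticOnNhd ℂ f (Metric.ball 0 1) := fun z hz =>
    Complex.analyticAt_sin.comp (analyticOnNhd_discLog α z hz)
  have hd : ∀ z ∈ Metric.ball (0 : ℂ) 1,
      HasDerivAt f (Complex.cos (discLog α z) * (1 / (1 + z) / (2 * α))) z := fun z hz =>
    (Complex.hasDerivAt_sin _).comp z (hasDerivAt_discLog α hz)
  have hd0 : ∀ z ∈ Metric.ball (0 : ℂ) 1, f z = 0 → deriv f z ≠ 0 := fun z hz h0 => by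
    rw [(hd z hz).deriv]
    -- All zeros are simple: sine and cosine have no common zero.
    refine mul_ne_zero (fun hc => ?_) (deriv_discLog_ne_zero hα hz)
    have := Complex.sin_sq_add_cos_sq (discLog α z)
    rw [hc, show Complex.sin (discLog α z) = 0 from h0] at this
    simp at this
  have h0m : (0 : ℂ) ∈ Metric.ball (0 : ℂ) 1 := by simp
  have hf0 : f 0 = 0 := by simp [hf_def, discLog]
  obtain ⟨g, hg, hg0, hfg⟩ := (hf 0 h0m).analyticOrderAt_eq_natCast (n := 1).1 (by
    rw [(hf 0 h0m).analyticOrderAt_eq_one_of_zero_deriv_ne_zero hf0 (hd0 0 h0m hf0)]; rfl)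
  have hfg' : ∀ᶠ z in 𝓝 0, f z = z ^ 1 * g z := by
    filter_upwards [hfg] with z hz
    simpa using hz
  have hgv : g 0 = 1 / (2 * α) := by
    have h1 : HasDerivAt (fun z => z ^ 1 * g z) (g 0) 0 := by
      have h := (hasDerivAt_pow 1 (0 : ℂ)).mul hg.differentiableAt.hasDerivAt
      exact h.congr_deriv (by simp)
    have h2 := (h1.congr_of_eventuallyEq hfg').unique (hd 0 h0m)
    rw [h2]
    simp [discLog]
  have hy : ∀ n : ℕ, -(2 * π * α * (n + 1)) < 0 := fun n => neg_lt_zero.2 (by positivity)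
  have hq : |exp (-π * α) ^ 2| < 1 := by
    rw [abs_of_pos (by positivity)]
    exact pow_lt_one₀ (exp_pos _).le (exp_lt_one_iff.2 (by nlinarith [mul_pos pi_pos hα]))
      (by norm_num)
  have hn : ∀ n : ℕ, -log ‖expPoint (-(2 * π * α * (n + 1)))‖ =
      -log (1 - (exp (-π * α) ^ 2) ^ (n + 1)) := fun n => by
    rw [norm_expPoint (hy n), ← exp_nat_mul, ← exp_nat_mul]
    congr 4; push_cast; ring
  have hfz : ∀ n : ℕ, f (expPoint (-(2 * π * α * (n + 1)))) = 0 := fun n => by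
    simp only [hf_def]
    rw [discLog_expPoint, Complex.sin_eq_zero_iff]
    refine ⟨-(n + 1), ?_⟩
    push_cast
    field_simp
  have hJ := tendsto_circleAverage_log_norm (ζ := fun n : ℕ => expPoint (-(2 * π * α * (n + 1))))
    hf hg hg0 hfg' (fun a b h => by
      have h1 := expPoint_injective h
      have h2 : 2 * π * α * ((a : ℝ) + 1) = 2 * π * α * (b + 1) := by linarith
      have h3 := mul_left_cancel₀ (by positivity) h2
      exact_mod_cast add_right_cancel h3)
    (fun n => expPoint_mem_ball (hy n)) (fun n => expPoint_ne_zero (hy n)) hfz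
    (fun n => hd0 _ (expPoint_mem_ball (hy n)) (hfz n))
    (fun z hz hz0 h => by
      obtain ⟨k, hk⟩ := Complex.sin_eq_zero_iff.1 h
      obtain ⟨h1, h2⟩ := eq_expPoint_of_discLog_eq hα hz (y := 2 * π * α * k) (by
        rw [hk]; push_cast; field_simp)
      have h3 : (k : ℝ) < 1 := by
        by_contra! h3
        nlinarith [mul_pos pi_pos hα]
      have h4 : k ≠ 0 := by
        rintro rfl
        exact hz0 (by rw [h1]; simp [expPoint])
      have h5 : k < 1 := by exact_mod_cast h3
      obtain ⟨n, hn⟩ := Int.eq_ofNat_of_zero_le (show 0 ≤ -k - 1 by omega)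
      refine ⟨n, ?_⟩
      have h6 : (k : ℝ) = -((n : ℝ) + 1) := by
        have : k = -((n : ℤ) + 1) := by omega
        rw [this]; push_cast; ring
      simp only
      rw [h1, h6]
      congr 1; ring)
    (by simp only [hn]; exact (summable_logEuler hq).neg)
  have := tendsto_nhds_unique
    (tendsto_circleAverage_comp_discLog Complex.continuous_sin abs_im_le_norm_sin norm_sin_le hα) hJ
  rw [this]
  simp only [hn]
  rw [tsum_neg, hgv, logEuler, norm_div, norm_one, norm_mul, Complex.norm_real, Complex.norm_ofNat,
    norm_of_nonneg hα.le, one_div, log_inv]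
  ring

/-- Here `log (1 + z) = πα(2k + 1)`, so `πα > log 2` is what excludes `k ≥ 0`. The function is 1 at
the origin, which therefore contributes nothing. -/
theorem circleAverage_log_norm_cos {α : ℝ} (hα : 0 < α) (hα2 : log 2 / π < α) :
    circleAverage (fun z => log ‖Complex.cos (discLog α z)‖) 0 1 =
      -logEulerOdd (exp (-π * α)) := by
  have hlog : log 2 < π * α := by rwa [div_lt_iff₀' (by positivity)] at hα2
  have hα' : (α : ℂ) ≠ 0 := Complex.ofReal_ne_zero.2 hα.ne'
  set f : ℂ → ℂ := fun z => Complex.cos (discLog α z) with hf_def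
  have hf : AnalyticOnNhd ℂ f (Metric.ball 0 1) := fun z hz =>
    Complex.analyticAt_cos.comp (analyticOnNhd_discLog α z hz)
  have hd0 : ∀ z ∈ Metric.ball (0 : ℂ) 1, f z = 0 → deriv f z ≠ 0 := fun z hz h0 => by
    have hd : HasDerivAt f (-Complex.sin (discLog α z) * (1 / (1 + z) / (2 * α))) z :=
      (Complex.hasDerivAt_cos _).comp z (hasDerivAt_discLog α hz)
    rw [hd.deriv]
    refine mul_ne_zero (neg_ne_zero.2 fun hc => ?_) (deriv_discLog_ne_zero hα hz)
    have := Complex.sin_sq_add_cos_sq (discLog α z)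
    rw [hc, show Complex.cos (discLog α z) = 0 from h0] at this
    simp at this
  have h0m : (0 : ℂ) ∈ Metric.ball (0 : ℂ) 1 := by simp
  have hf0 : f 0 = 1 := by simp [hf_def, discLog]
  have hy : ∀ n : ℕ, -(π * α * (2 * n + 1)) < 0 := fun n => neg_lt_zero.2 (by positivity)
  have hq : |exp (-π * α)| < 1 := by
    rw [abs_of_pos (by positivity)]
    exact exp_lt_one_iff.2 (by nlinarith [mul_pos pi_pos hα])
  have hn : ∀ n : ℕ, -log ‖expPoint (-(π * α * (2 * n + 1)))‖ =
      -log (1 - exp (-π * α) ^ (2 * n + 1)) := fun n => by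
    rw [norm_expPoint (hy n), ← exp_nat_mul]
    congr 4; push_cast; ring
  have hfz : ∀ n : ℕ, f (expPoint (-(π * α * (2 * n + 1)))) = 0 := fun n => by
    simp only [hf_def]
    rw [discLog_expPoint, Complex.cos_eq_zero_iff]
    -- `2k + 1 = -(2n + 1)` at `k = -(n + 1)`.
    refine ⟨-(n + 1), ?_⟩
    push_cast
    field_simp
    ring
  have hJ := tendsto_circleAverage_log_norm (ζ := fun n : ℕ => expPoint (-(π * α * (2 * n + 1))))
    (m := 0) hf (hf 0 h0m) (by rw [hf0]; exact one_ne_zero) (by simp) (fun a b h => by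
      have h1 := expPoint_injective h
      have h2 : π * α * (2 * (a : ℝ) + 1) = π * α * (2 * b + 1) := by linarith
      have h3 := mul_left_cancel₀ (by positivity) h2
      have h4 : (a : ℝ) = b := by linarith
      exact_mod_cast h4)
    (fun n => expPoint_mem_ball (hy n)) (fun n => expPoint_ne_zero (hy n)) hfz
    (fun n => hd0 _ (expPoint_mem_ball (hy n)) (hfz n))
    (fun z hz hz0 h => by
      obtain ⟨k, hk⟩ := Complex.cos_eq_zero_iff.1 h
      obtain ⟨h1, h2⟩ := eq_expPoint_of_discLog_eq hα hz (y := π * α * (2 * k + 1)) (by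
        rw [hk]; push_cast; field_simp)
      have h3 : (k : ℝ) < 0 := by
        by_contra! h3
        nlinarith [mul_pos pi_pos hα]
      have h5 : k < 0 := by exact_mod_cast h3
      obtain ⟨n, hn⟩ := Int.eq_ofNat_of_zero_le (show 0 ≤ -k - 1 by omega)
      refine ⟨n, ?_⟩
      have h6 : (k : ℝ) = -((n : ℝ) + 1) := by
        have : k = -((n : ℤ) + 1) := by omega
        rw [this]; push_cast; ring
      simp only
      rw [h1, h6]
      congr 1; ring)
    (by simp only [hn]; exact (summable_logEulerOdd hq).neg)
  have := tendsto_nhds_unique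
    (tendsto_circleAverage_comp_discLog Complex.continuous_cos abs_im_le_norm_cos norm_cos_le hα) hJ
  rw [this]
  simp only [hn]
  rw [tsum_neg, hf0, logEulerOdd, norm_one, log_one, add_zero]

/-! ### Assembly -/

theorem log_two_mul_norm_sq {F : ℂ → ℂ} (hl : ∀ u, |u.im| ≤ ‖F u‖) {α : ℝ} (hα : 0 < α) {x : ℝ}
    (hx : x ∈ Set.Ioo 0 (π / 2)) :
    log (2 * ‖F (discLog α (circleMap 0 1 (2 * x)))‖ ^ 2) =
      log 2 + 2 * log ‖F (discLog α (circleMap 0 1 (2 * x)))‖ := by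
  have hs : 0 < |sin (2 * x)| := abs_pos.2
    (sin_pos_of_pos_of_lt_pi (by linarith [hx.1]) (by linarith [hx.2])).ne'
  have h0 : 0 < ‖F (discLog α (circleMap 0 1 (2 * x)))‖ :=
    (by positivity : 0 < |sin (2 * x)| / (8 * α)).trans_le
      ((abs_sin_div_le_discLog_im hα (by norm_num)).trans (hl _))
  rw [log_mul two_ne_zero (by positivity), log_pow]
  push_cast; rfl

theorem two_mul_discLog_re_im {α : ℝ} {x : ℝ} (hx : x ∈ Set.Ioo 0 (π / 2)) :
    2 * (discLog α (circleMap 0 1 (2 * x))).re = log (2 * cos x) / α ∧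
      2 * (discLog α (circleMap 0 1 (2 * x))).im = x / α := by
  have h : discLog α (circleMap 0 1 (2 * x)) =
      ((log (2 * cos x) / (2 * α) : ℝ) : ℂ) + ((x / (2 * α) : ℝ) : ℂ) * Complex.I := by
    rw [discLog_circleMap hx]; push_cast; ring
  rw [h, Complex.add_re, Complex.add_im,
    Complex.re_ofReal_mul, Complex.im_ofReal_mul, Complex.ofReal_re, Complex.ofReal_im, Complex.I_re, Complex.I_im]
  constructor
  · field_simp; ring
  · field_simp; ring

theorem theorem1 (α : ℝ) (hα : 0 < α) :
    (∃! k : ℝ, k ∈ Set.Ioo (0 : ℝ) 1 ∧ ellipticK (complModulus k) / ellipticK k = α) ∧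
    ∀ k ∈ Set.Ioo (0 : ℝ) 1, ellipticK (complModulus k) / ellipticK k = α →
      (log 2 / (2 * π) < α →
        IntervalIntegrable (fun x : ℝ => log (cosh (x / α) - cos (log (2 * cos x) / α)))
          MeasureTheory.volume 0 (π / 2) ∧
        ∫ x in (0 : ℝ)..(π / 2), log (cosh (x / α) - cos (log (2 * cos x) / α)) =
          -(π ^ 2 * α / 12) -
            π / 6 * log (16 * k * complModulus k * ellipticK k ^ 3 * α ^ 6 / π ^ 3)) ∧
      (log 2 / π < α →
        IntervalIntegrable (fun x : ℝ => log (cosh (x / α) + cos (log (2 * cos x) / α)))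
          MeasureTheory.volume 0 (π / 2) ∧
        ∫ x in (0 : ℝ)..(π / 2), log (cosh (x / α) + cos (log (2 * cos x) / α)) =
          π ^ 2 * α / 24 + π / 6 * log (4 * √k / complModulus k)) := by
  have hq0 := exp_pos (-π * α)
  have hq1 : exp (-π * α) < 1 := exp_lt_one_iff.2 (by nlinarith [mul_pos pi_pos hα])
  have h8 : log 8 = 3 * log 2 := by
    rw [show (8 : ℝ) = 2 ^ 3 by norm_num, log_pow]; push_cast; rfl
  refine ⟨⟨modulusOfNome (exp (-π * α)), ⟨modulusOfNome_mem hq0 hq1,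
    ellipticK_complModulus_div hα⟩, fun k hk => eq_modulusOfNome hα hk.1 hk.2⟩, ?_⟩
  intro k hk hkα
  obtain rfl := eq_modulusOfNome hα hk hkα
  constructor
  · intro h
    have hI := integral_eq_circleAverage Complex.continuous_sin abs_im_le_norm_sin norm_sin_le
      Complex.sin_conj hα (H := fun x => log (cosh (x / α) - cos (log (2 * cos x) / α)))
      (fun x hx => by
        rw [← log_two_mul_norm_sq abs_im_le_norm_sin hα hx, norm_sin_sq,
          (two_mul_discLog_re_im hx).1, (two_mul_discLog_re_im hx).2,
          mul_div_cancel₀ _ two_ne_zero])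
    refine ⟨hI.1, ?_⟩
    -- The term `π²α/12` cancels the contribution of `√q` inside the logarithm.
    rw [hI.2, circleAverage_log_norm_sin hα h, log_mul two_ne_zero hα.ne',
      mul_div_right_comm _ (α ^ 6), modulus_prod_eq hq0 hq1,
      log_mul (by positivity) (by positivity), log_mul (by positivity) (by positivity),
      log_mul (by positivity) (by positivity), log_pow, log_pow, log_exp, log_sqrt hq0.le, log_exp,
      h8]
    push_cast
    ring
  · intro h
    have hI := integral_eq_circleAverage Complex.continuous_cos abs_im_le_norm_cos norm_cos_le
      Complex.cos_conj hα (H := fun x => log (cosh (x / α) + cos (log (2 * cos x) / α)))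
      (fun x hx => by
        rw [← log_two_mul_norm_sq abs_im_le_norm_cos hα hx, norm_cos_sq,
          (two_mul_discLog_re_im hx).1, (two_mul_discLog_re_im hx).2,
          mul_div_cancel₀ _ two_ne_zero])
    refine ⟨hI.1, ?_⟩
    -- Here `π²α/24` cancels the contribution of `√√q`.
    rw [hI.2, circleAverage_log_norm_cos hα h, modulus_quot_eq hq0 hq1,
      log_div (by positivity) (by positivity), log_mul (by positivity) (by positivity), log_pow,
      log_exp, log_sqrt (by positivity), log_sqrt hq0.le, log_exp, h8]
    push_cast
    ring
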